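/- Let $d\ge 1$, $\mathscr X=(0,1)^d$, and let $k(x,x')=\prod_{j=1}^d[\theta_j+\gamma_j\min(x_j,x'_j)]$ with constants $\theta_j,\gamma_j>0$ (a Brownian field kernel). For $\tau\ge1$ let $$\mathcal X_\tau=\bigcup_{l\in\{1,2,\dots\}^d,\ l_1+\dots+l_d\le\tau+d-1}\ \prod_{j=1}^d\{i\,2^{-l_j}:1\le i\le 2^{l_j}-1\}$$ be the classical sparse grid of level $\tau$, and put $N_\tau=|\mathcal X_\tau|$. *The algorithm KEIBS (noise-free samples, $\lambda=0$, $\delta_n=1$).* For points $x_1,\dots,x_n$ write $K_n=(k(x_i,x_j))_{i,j\le n}$ and $k_n(x)=(k(x_1,x),\dots,k(x_n,x))^{\top}$. Given a function $f$ on $\mathscr X$ and a budget $N\ge1$, let $\tau\ge 1$ be the level with $N_\tau\le N<N_{\tau+1}$. Stage 1: let $\{x_1,\dots,x_{N_\tau}\}=\mathcal X_\tau$, in any order, and $$\breve f_{N_\tau}(x)=k_{N_\tau}(x)^{\top}K_{N_\tau}^{-1}\,(f(x_i))_{i\le N_\tau}.$$ For $n\ge N_\tau$ put $$\tilde f_n(x)=\breve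 f_{N_\tau}(x)+k_n(x)^{\top}K_n^{-1}\bigl(f(x_i)-\breve f_{N_\tau}(x_i)\bigr)_{i\le n},\qquad s_n^2(x)=k(x,x)-k_n(x)^{\top}K_n^{-1}k_n(x).$$ Stage 2: for $n=N_\tau,\dots,N-1$ let $x_{n+1}$ be any maximizer over $x\in\mathcal X_{\tau+1}$ of the expected improvement $$s_n(x)\,\eta\Bigl(\bigl(\tilde f_n(x)-\max_{i\le n}\tilde f_n(x_i)\bigr)/s_n(x)\Bigr),\qquad \eta(t)=t\,\Phi(t)+\varphi(t),$$ where $\Phi,\varphi$ are the standard normal distribution function and density, and the expected improvement is $0$ where $s_n(x)=0$. The output $\hat x^*_N$ is a maximizer of $\tilde f_N$ over $\mathscr X$. *Theorem.* Let $f\in\mathscr H^1_{\mathsf{mix}}$, that is, $f\in L^2(\mathscr X)$ and all weak partial derivatives $D^\alpha f$ with $\alpha\in\{0,1\}^d$ exist and lie in $L^2(\mathscr X)$; as usual, $f$ stands for the continuous representative of its class. Suppose that $f$ has a global maximum at $x^*\in\mathscr X$. Then there is a constant $C$ such that for every $N\ge2$ and every run of KEIBS with budget $N$, $$f(x^*)-f(\hat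 x^*_N)\ \le\ C\,N^{-1/2}(\log N)^{3(d-1)/2}$$ for every maximizer $\hat x^*_N\in\mathscr X$ of $\tilde f_N$ over $\mathscr X$. More generally, since $\tilde f_N$ need not attain its supremum on the open cube: for every $\varepsilon\ge0$ and every $\hat x\in\mathscr X$ with $\tilde f_N(z)\le\tilde f_N(\hat x)+\varepsilon$ for all $z\in\mathscr X$, one has $f(x^*)-f(\hat x)\le C\,N^{-1/2}(\log N)^{3(d-1)/2}+\varepsilon$. -/

import Mathlib

open MeasureTheory ProbabilityTheory
open scoped Matrix ContDiff

noncomputable section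

/-- The open unit cube `(0,1)^d`, the feasible set. -/
def unitCube (d : ℕ) : Set (Fin d → ℝ) := {x | ∀ j, 0 < x j ∧ x j < 1}

/-! ### Sobolev spaces with dominating mixed smoothness -/

/-- The classical partial derivative `∂φ/∂x_j`. -/
def partialDeriv {d : ℕ} (j : Fin d) (φ : (Fin d → ℝ) → ℝ) (x : Fin d → ℝ) : ℝ :=
  fderiv ℝ φ x (Pi.single j 1)

/-- The classical mixed partial derivative `∏_{j ∈ S} ∂/∂x_j` of order `|S|` (once in each
direction of `S`) of a function `φ`; it is only used for smooth `φ`, where the order of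
differentiation is immaterial. -/
def mixedPartial {d : ℕ} (S : Finset (Fin d)) (φ : (Fin d → ℝ) → ℝ) : (Fin d → ℝ) → ℝ :=
  (S.sort (· ≤ ·)).foldr partialDeriv φ

/-- `g` is the weak mixed partial derivative `∏_{j ∈ S} ∂/∂x_j f` on the open unit cube:
`∫ f ∂^S φ = (-1)^{|S|} ∫ g φ` for all smooth `φ` with compact support in the cube. -/
def IsWeakMixedPartial {d : ℕ} (S : Finset (Fin d)) (f g : (Fin d → ℝ) → ℝ) : Prop :=
  ∀ φ : (Fin d → ℝ) → ℝ, ContDiff ℝ ∞ φ → HasCompactSupport φ → tsupport φ ⊆ unitCube d →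
    ∫ x in unitCube d, f x * mixedPartial S φ x =
      (-1) ^ S.card * ∫ x in unitCube d, g x * φ x

/-- The order-one Sobolev space with dominating mixed smoothness on `(0,1)^d`: functions in `L²`
all of whose weak derivatives `D^α f` with `α ∈ {0,1}^d` are in `L²`.  The multi-index `α` is
encoded as the set `S` of the coordinates `j` with `α_j = 1`. -/
def MemHMixOne {d : ℕ} (f : (Fin d → ℝ) → ℝ) : Prop :=
  MemLp f 2 (volume.restrict (unitCube d)) ∧
    ∀ S : Finset (Fin d), ∃ g : (Fin d → ℝ) → ℝ,
      MemLp g 2 (volume.restrict (unitCube d)) ∧ IsWeakMixedPartial S f g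

/-! ### Brownian field kernels -/

/-- The Brownian field kernel `∏_j (θ_j + γ_j min(x_j, x'_j))`. -/
def bfKernel {d : ℕ} (θ γ : Fin d → ℝ) (x x' : Fin d → ℝ) : ℝ :=
  ∏ j, (θ j + γ j * min (x j) (x' j))

/-! ### Classical sparse grids -/

/-- The one-dimensional dyadic grid `{i 2^{-l} : i = 1, …, 2^l - 1}`. -/
def dyadicGrid (l : ℕ) : Finset ℝ :=
  (Finset.Icc 1 (2 ^ l - 1)).image fun i : ℕ => (i : ℝ) / 2 ^ l

/-- The classical sparse grid of level `τ ≥ 1` in dimension `d ≥ 1`: the union of the full grids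
`∏_j dyadicGrid (l_j)` over all `l` with `l_j ≥ 1` and `l_1 + ⋯ + l_d ≤ τ + d - 1`.
(These constraints force `l_j ≤ τ`, so that `l` ranges over a finite set.) -/
def sparseGrid (d τ : ℕ) : Finset (Fin d → ℝ) :=
  ((Fintype.piFinset fun _ : Fin d => Finset.Icc 1 τ).filter
      fun l => ∑ j, l j ≤ τ + d - 1).biUnion
    fun l => Fintype.piFinset fun j => dyadicGrid (l j)

/-! ### The algorithm

Design points and observations are sequences indexed from `0`, so that `x 0, …, x (n - 1)` are the
first `n` design points and `y i` is the observation taken at `x i`. -/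

/-- The kernel matrix of the first `n` design points. -/
def kernelMatrix {d : ℕ} (θ γ : Fin d → ℝ) (x : ℕ → Fin d → ℝ) (n : ℕ) :
    Matrix (Fin n) (Fin n) ℝ :=
  Matrix.of fun i j => bfKernel θ γ (x i) (x j)

/-- The vector of the values `k(x_i, z)` over the first `n` design points. -/
def kernelVec {d : ℕ} (θ γ : Fin d → ℝ) (x : ℕ → Fin d → ℝ) (n : ℕ) (z : Fin d → ℝ) :
    Fin n → ℝ :=
  fun i => bfKernel θ γ (x i) z

/-- The kernel ridge regression estimate from the first `n` observations,
`k_n(z)ᵀ (K_n + n λ I)⁻¹ y_n`. -/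
def krr {d : ℕ} (θ γ : Fin d → ℝ) (lam : ℝ) (x : ℕ → Fin d → ℝ) (y : ℕ → ℝ) (n : ℕ)
    (z : Fin d → ℝ) : ℝ :=
  kernelVec θ γ x n z ⬝ᵥ
    ((kernelMatrix θ γ x n + ((n : ℝ) * lam) • (1 : Matrix (Fin n) (Fin n) ℝ))⁻¹ *ᵥ
      fun i : Fin n => y i)

/-- The Stage 2 surrogate mean after `n` samples, `n₀` of which were taken in Stage 1:
`f̂(z) + δ_n² k_n(z)ᵀ (δ_n² K_n + σ² I)⁻¹ (y_n - f̂_n)`, with `f̂` the Stage 1 estimate. -/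
def surrogateMean {d : ℕ} (θ γ : Fin d → ℝ) (σ lam : ℝ) (δ : ℕ → ℝ) (n₀ : ℕ)
    (x : ℕ → Fin d → ℝ) (y : ℕ → ℝ) (n : ℕ) (z : Fin d → ℝ) : ℝ :=
  krr θ γ lam x y n₀ z +
    δ n ^ 2 * (kernelVec θ γ x n z ⬝ᵥ
      ((δ n ^ 2 • kernelMatrix θ γ x n + σ ^ 2 • (1 : Matrix (Fin n) (Fin n) ℝ))⁻¹ *ᵥ
        fun i : Fin n => y i - krr θ γ lam x y n₀ (x i)))

/-- The Stage 2 surrogate variance `s_n²(z)` after `n` samples: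
`δ_n² k(z,z) - δ_n² k_n(z)ᵀ (δ_n² K_n + σ² I)⁻¹ (δ_n² k_n(z))`. -/
def surrogateVar {d : ℕ} (θ γ : Fin d → ℝ) (σ : ℝ) (δ : ℕ → ℝ)
    (x : ℕ → Fin d → ℝ) (n : ℕ) (z : Fin d → ℝ) : ℝ :=
  δ n ^ 2 * bfKernel θ γ z z -
    δ n ^ 2 * (kernelVec θ γ x n z ⬝ᵥ
      ((δ n ^ 2 • kernelMatrix θ γ x n + σ ^ 2 • (1 : Matrix (Fin n) (Fin n) ℝ))⁻¹ *ᵥ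
        (δ n ^ 2 • kernelVec θ γ x n z)))

/-- The information value function `η(t) = t Φ(t) + φ(t)`, with `Φ` and `φ` the distribution
function and the density of the standard normal distribution. -/
def infoValue (t : ℝ) : ℝ := t * cdf (gaussianReal 0 1) t + gaussianPDFReal 0 1 t

/-- The expected improvement acquisition function
`s_n(z) η((f̃_n(z) - max_{i ≤ n} f̃_n(x_i)) / s_n(z))`.  Where `s_n(z) = 0` its value is `0`; for
noise-free samples this happens only at points already sampled, where `0` is also the limit of the
expression as `s_n(z)` tends to `0`. -/
def expectedImprovement {d : ℕ} (θ γ : Fin d → ℝ) (σ lam : ℝ) (δ : ℕ → ℝ) (n₀ : ℕ)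
    (x : ℕ → Fin d → ℝ) (y : ℕ → ℝ) (n : ℕ) (z : Fin d → ℝ) : ℝ :=
  √(surrogateVar θ γ σ δ x n z) *
    infoValue
      ((surrogateMean θ γ σ lam δ n₀ x y n z -
          ⨆ i : Fin n, surrogateMean θ γ σ lam δ n₀ x y n (x i)) /
        √(surrogateVar θ γ σ δ x n z))

/-- `x 0, …, x (N - 1)` are the design points of a run of the algorithm with budget `N`, in which
`y i` was observed at `x i` and sparse grid level `τ` was selected in Stage 1.  Ties in the
selection of a design point may be broken in any way. -/
structure IsKEIBSRun {d : ℕ} (θ γ : Fin d → ℝ) (σ lam : ℝ) (δ : ℕ → ℝ) (N τ : ℕ)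
    (x : ℕ → Fin d → ℝ) (y : ℕ → ℝ) : Prop where
  one_le_level : 1 ≤ τ
  card_le : (sparseGrid d τ).card ≤ N
  lt_card : N < (sparseGrid d (τ + 1)).card
  /-- Stage 1: the first `|sparseGrid d τ|` design points enumerate the sparse grid. -/
  stage_one : (Finset.range (sparseGrid d τ).card).image x = sparseGrid d τ
  /-- Stage 2: each further design point lies in the sparse grid of level `τ + 1` and maximizes
  the acquisition function over it. -/
  stage_two : ∀ n, (sparseGrid d τ).card ≤ n → n < N →
    x n ∈ sparseGrid d (τ + 1) ∧
      IsMaxOn (expectedImprovement θ γ σ lam δ (sparseGrid d τ).card x y n)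
        (sparseGrid d (τ + 1)) (x n)

end

/-! The kernel has a feature map: `bfKernel θ γ x x'` is the inner product of the orthant indicators
`orthantFn x` and `orthantFn x'` in `L²(fieldMeasure θ γ)`. So every kernel quadratic form is the
squared norm of a combination of indicators.

If `f` satisfies `KernelBounded`, the error of a linear rule with weights `c` at `z` is at most `M`
times the norm of the feature of `z` minus the `c`-combination of the features of the design points.
The interpolation weights minimize that norm, so any element of the span may replace the combination
(`KernelBounded.exists_abs_sub_interpolant_le`).

Since the design contains the sparse grid, a sparse grid approximation of the feature will do. Each
coordinate's step function telescopes along dyadic levels with increments of norm of order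
`2^(-l/2)`. Dropping the products of total level at least `τ` leaves an error of order `(τ+1)^(d-1)
2^(-τ/2)` (`exists_mem_span_integral_sq_le`).

That a continuous `f` with `MemHMixOne f` is `KernelBounded` (`MemHMixOne.kernelBounded`) comes from
writing `f x` through integrals of its weak mixed derivatives against products of step functions
(`eq_sum_integral_weakMixedPartial`), followed by Cauchy–Schwarz.

The algorithm enters in three ways. The final surrogate is the plain interpolant
(`surrogateMean_eq_interpolant`). No point is sampled twice, because expected improvement vanishes
at sampled points and is positive elsewhere on the cube (`IsKEIBSRun.injective`), so the kernel
matrix is invertible. Finally, `N` is below the size of the next sparse grid, so `2^(-τ/2)` is at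
most of order `N^(-1/2) (log N)^((d-1)/2)`; with `τ` of order at most `log N`, this gives the
exponent `3(d-1)/2`. Beyond this, the selection rule of Stage 2 plays no role. Optimality of the
surrogate costs twice the uniform error. -/

/-! ### The feature map of the Brownian field kernel. -/

/-- The indicator of `(-∞, x]`. -/
noncomputable def stepFn (x t : ℝ) : ℝ := if t ≤ x then 1 else 0

/-- The indicator of the orthant below `x`; these functions represent the Brownian field kernel as
an `L²` inner product. -/
noncomputable def orthantFn {d : ℕ} (x t : Fin d → ℝ) : ℝ := ∏ j, stepFn (x j) (t j)

/-- The measure on the line with an atom of mass `θ` at `0` and density `γ` on `(0,1)`. -/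
noncomputable def coordMeasure (θ γ : ℝ) : Measure ℝ :=
  θ.toNNReal • Measure.dirac 0 + γ.toNNReal • volume.restrict (Set.Ioo 0 1)

instance (θ γ : ℝ) : IsFiniteMeasure (coordMeasure θ γ) := by
  unfold coordMeasure; infer_instance

/-- The product of the measures `coordMeasure (θ j) (γ j)`. -/
noncomputable def fieldMeasure {d : ℕ} (θ γ : Fin d → ℝ) : Measure (Fin d → ℝ) :=
  Measure.pi fun j => coordMeasure (θ j) (γ j)

instance {d : ℕ} (θ γ : Fin d → ℝ) : IsFiniteMeasure (fieldMeasure θ γ) := by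
  unfold fieldMeasure; infer_instance

lemma measurable_stepFn (x : ℝ) : Measurable (stepFn x) :=
  Measurable.ite measurableSet_Iic measurable_const measurable_const

lemma stepFn_nonneg (x t : ℝ) : 0 ≤ stepFn x t := by unfold stepFn; split_ifs <;> norm_num

lemma stepFn_le_one (x t : ℝ) : stepFn x t ≤ 1 := by unfold stepFn; split_ifs <;> norm_num

lemma abs_stepFn_le_one (x t : ℝ) : |stepFn x t| ≤ 1 := by
  rw [abs_of_nonneg (stepFn_nonneg x t)]; exact stepFn_le_one x t

lemma stepFn_mul_stepFn (x x' t : ℝ) : stepFn x t * stepFn x' t = stepFn (min x x') t := by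
  unfold stepFn; simp only [le_min_iff]; split_ifs <;> simp_all

lemma integrable_stepFn (μ : Measure ℝ) [IsFiniteMeasure μ] (x : ℝ) : Integrable (stepFn x) μ :=
  Integrable.of_bound (measurable_stepFn x).aestronglyMeasurable 1
    (.of_forall fun t => by simpa using abs_stepFn_le_one x t)

lemma integral_stepFn_Ioo {x : ℝ} (h0 : 0 < x) (h1 : x < 1) :
    ∫ t in Set.Ioo (0 : ℝ) 1, stepFn x t = x := by
  have : stepFn x = (Set.Iic x).indicator fun _ => (1 : ℝ) := by
    ext t; simp [stepFn, Set.indicator]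
  rw [this, setIntegral_indicator measurableSet_Iic]
  have : Set.Ioo (0 : ℝ) 1 ∩ Set.Iic x = Set.Ioc 0 x := by
    ext t; simp only [Set.mem_inter_iff, Set.mem_Ioo, Set.mem_Iic, Set.mem_Ioc]
    constructor
    · rintro ⟨⟨h, -⟩, h'⟩; exact ⟨h, h'⟩
    · rintro ⟨h, h'⟩; exact ⟨⟨h, by linarith⟩, h'⟩
  simp [this, h0.le]

lemma integral_coordMeasure {θ γ : ℝ} (hθ : 0 ≤ θ) (hγ : 0 ≤ γ) {g : ℝ → ℝ} {c : ℝ}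
    (hg : Measurable g) (hb : ∀ t, |g t| ≤ c) :
    ∫ t, g t ∂coordMeasure θ γ = θ * g 0 + γ * ∫ t in Set.Ioo (0 : ℝ) 1, g t := by
  have hi : ∀ (μ : Measure ℝ) [IsFiniteMeasure μ], Integrable g μ := fun μ _ =>
    Integrable.of_bound hg.aestronglyMeasurable c (.of_forall hb)
  unfold coordMeasure
  rw [integral_add_measure (hi _) (hi _), integral_smul_nnreal_measure,
    integral_smul_nnreal_measure, integral_dirac]
  simp [NNReal.smul_def, hθ, hγ]

lemma integral_stepFn_mul {θ γ : ℝ} (hθ : 0 ≤ θ) (hγ : 0 ≤ γ) {x x' : ℝ}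
    (hx : 0 < x ∧ x < 1) (hx' : 0 < x' ∧ x' < 1) :
    ∫ t, stepFn x t * stepFn x' t ∂coordMeasure θ γ = θ + γ * min x x' := by
  simp only [stepFn_mul_stepFn]
  rw [integral_coordMeasure hθ hγ (measurable_stepFn _) (abs_stepFn_le_one _),
    integral_stepFn_Ioo (lt_min hx.1 hx'.1) (min_lt_of_left_lt hx.2)]
  simp [stepFn, hx.1.le, hx'.1.le]

lemma measurable_orthantFn {d : ℕ} (x : Fin d → ℝ) : Measurable (orthantFn x) :=
  Finset.measurable_prod _ fun j _ => (measurable_stepFn _).comp (measurable_pi_apply j)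

lemma abs_orthantFn_le_one {d : ℕ} (x t : Fin d → ℝ) : |orthantFn x t| ≤ 1 := by
  unfold orthantFn
  rw [Finset.abs_prod]
  exact Finset.prod_le_one (fun _ _ => abs_nonneg _) fun j _ => abs_stepFn_le_one _ _

lemma integral_orthantFn_mul {d : ℕ} {θ γ : Fin d → ℝ} (hθ : ∀ j, 0 < θ j) (hγ : ∀ j, 0 < γ j)
    {x x' : Fin d → ℝ} (hx : x ∈ unitCube d) (hx' : x' ∈ unitCube d) :
    ∫ t, orthantFn x t * orthantFn x' t ∂fieldMeasure θ γ = bfKernel θ γ x x' := by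
  simp only [orthantFn, ← Finset.prod_mul_distrib, fieldMeasure, bfKernel]
  rw [integral_fintype_prod_eq_prod (fun j t => stepFn (x j) t * stepFn (x' j) t)]
  exact Finset.prod_congr rfl fun j _ => integral_stepFn_mul (hθ j).le (hγ j).le (hx j) (hx' j)

lemma integrable_orthantFn_mul {d : ℕ} (μ : Measure (Fin d → ℝ)) [IsFiniteMeasure μ]
    (x z : Fin d → ℝ) : Integrable (fun t => orthantFn x t * orthantFn z t) μ :=
  Integrable.of_bound ((measurable_orthantFn x).mul (measurable_orthantFn z)).aestronglyMeasurable 1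
    (.of_forall fun t => by
      rw [norm_mul]
      exact mul_le_one₀ (abs_orthantFn_le_one x t) (norm_nonneg _) (abs_orthantFn_le_one z t))

/-! ### The kernel quadratic form and its strict positivity. -/

/-- The quadratic form of the kernel at the points `p i`. -/
noncomputable def kernelForm {d : ℕ} {ι : Type*} [Fintype ι] (θ γ : Fin d → ℝ)
    (p : ι → Fin d → ℝ) (a : ι → ℝ) : ℝ :=
  ∑ i, ∑ l, a i * a l * bfKernel θ γ (p i) (p l)

lemma kernelForm_eq_integral {d : ℕ} {ι : Type*} [Fintype ι] {θ γ : Fin d → ℝ}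
    (hθ : ∀ j, 0 < θ j) (hγ : ∀ j, 0 < γ j) {p : ι → Fin d → ℝ} (hp : ∀ i, p i ∈ unitCube d)
    (a : ι → ℝ) :
    kernelForm θ γ p a = ∫ t, (∑ i, a i * orthantFn (p i) t) ^ 2 ∂fieldMeasure θ γ := by
  have h : ∀ t, (∑ i, a i * orthantFn (p i) t) ^ 2 =
      ∑ i, ∑ l, a i * a l * (orthantFn (p i) t * orthantFn (p l) t) := fun t => by
    rw [sq, Finset.sum_mul_sum]
    exact Finset.sum_congr rfl fun i _ => Finset.sum_congr rfl fun l _ => by ring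
  simp only [h]
  rw [integral_finsetSum _ fun i _ => integrable_finsetSum _ fun l _ =>
    (integrable_orthantFn_mul _ _ _).const_mul _]
  refine Finset.sum_congr rfl fun i _ => ?_
  rw [integral_finsetSum _ fun l _ => (integrable_orthantFn_mul _ _ _).const_mul _]
  refine Finset.sum_congr rfl fun l _ => ?_
  rw [integral_const_mul, integral_orthantFn_mul hθ hγ (hp i) (hp l)]

lemma kernelForm_nonneg {d : ℕ} {ι : Type*} [Fintype ι] {θ γ : Fin d → ℝ}
    (hθ : ∀ j, 0 < θ j) (hγ : ∀ j, 0 < γ j) {p : ι → Fin d → ℝ} (hp : ∀ i, p i ∈ unitCube d)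
    (a : ι → ℝ) : 0 ≤ kernelForm θ γ p a := by
  rw [kernelForm_eq_integral hθ hγ hp]
  exact integral_nonneg fun t => sq_nonneg _

lemma coordMeasure_Ioo_pos {θ γ : ℝ} (hγ : 0 < γ) {u v : ℝ} (hu : 0 ≤ u) (huv : u < v)
    (hv : v < 1) : 0 < coordMeasure θ γ (Set.Ioo u v) := by
  have h : 0 < (γ.toNNReal • volume.restrict (Set.Ioo (0 : ℝ) 1)) (Set.Ioo u v) := by
    rw [Measure.smul_apply, Measure.restrict_apply measurableSet_Ioo,
      Set.inter_eq_left.2 (Set.Ioo_subset_Ioo hu hv.le), Real.volume_Ioo, ENNReal.smul_def]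
    exact ENNReal.mul_pos (by simpa using hγ) (by simpa using huv)
  exact h.trans_le (by unfold coordMeasure; exact Measure.le_add_left le_rfl _)

/-- Take `i` with the largest coordinate sum among the nonzero coefficients. Any other such point is
smaller than `p i` in some coordinate, so its orthant misses a thin enough box just below the corner
`p i`. -/
lemma exists_sum_orthantFn_eq {d : ℕ} {ι : Type*} [Fintype ι] {p : ι → Fin d → ℝ}
    (hp : ∀ i, p i ∈ unitCube d) (hinj : Function.Injective p) {a : ι → ℝ} (ha : a ≠ 0) :
    ∃ (u : Fin d → ℝ) (i : ι), a i ≠ 0 ∧ (∀ j, 0 ≤ u j) ∧ (∀ j, u j < p i j) ∧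
      ∀ t ∈ Set.univ.pi fun j => Set.Ioo (u j) (p i j), ∑ l, a l * orthantFn (p l) t = a i := by
  classical
  obtain ⟨i, hi, hmax⟩ := Finset.exists_max_image (Finset.univ.filter fun i => a i ≠ 0)
    (fun i => ∑ j, p i j) (by
      obtain ⟨i, hi⟩ := Function.ne_iff.1 ha
      exact ⟨i, by simpa using hi⟩)
  have hex : ∀ j, ∃ u, 0 ≤ u ∧ u < p i j ∧ ∀ l, p l j < p i j → p l j ≤ u := fun j => by
    have : ∀ᶠ u in nhdsWithin (p i j) (Set.Iio (p i j)),
        ∀ l, p l j < p i j → p l j ≤ u := by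
      rw [Filter.eventually_all]
      intro l
      by_cases h : p l j < p i j
      · filter_upwards [Ioo_mem_nhdsLT h] with u hu _ using hu.1.le
      · exact .of_forall fun u h' => absurd h' h
    obtain ⟨u, hu, hu'⟩ := (this.and (Ioo_mem_nhdsLT (hp i j).1)).exists
    exact ⟨u, hu'.1.le, hu'.2, hu⟩
  choose u hu0 hui hul using hex
  refine ⟨u, i, (Finset.mem_filter.1 hi).2, hu0, hui, fun t ht => ?_⟩
  have ht' : ∀ j, u j < t j ∧ t j < p i j := fun j => ht j (Set.mem_univ j)
  rw [Finset.sum_eq_single i]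
  · have : orthantFn (p i) t = 1 := Finset.prod_eq_one fun j _ => by simp [stepFn, (ht' j).2.le]
    rw [this, mul_one]
  · intro l _ hl
    by_cases hal : a l = 0
    · simp [hal]
    have : ∃ j, p l j < p i j := by
      by_contra! h
      have h2 := hmax l (by simpa using hal)
      have h3 : ∑ j, p i j = ∑ j, p l j :=
        le_antisymm (Finset.sum_le_sum fun j _ => h j) h2
      have h4 := (Finset.sum_eq_sum_iff_of_le fun j _ => h j).1 h3
      exact hl (hinj (funext fun j => (h4 j (Finset.mem_univ j)).symm))
    obtain ⟨j, hj⟩ := this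
    have : orthantFn (p l) t = 0 := Finset.prod_eq_zero (Finset.mem_univ j) (by
      have := hul j l hj
      have := (ht' j).1
      simp only [stepFn, ite_eq_right_iff, one_ne_zero, imp_false, not_le]
      linarith)
    rw [this, mul_zero]
  · simp

/-- The integrand is a nonzero constant on a box, and the density part of the measure charges that
box. Invertibility of kernel matrices and positivity of the variance both rest on this. -/
lemma kernelForm_pos {d : ℕ} {ι : Type*} [Fintype ι] {θ γ : Fin d → ℝ}
    (hθ : ∀ j, 0 < θ j) (hγ : ∀ j, 0 < γ j) {p : ι → Fin d → ℝ} (hp : ∀ i, p i ∈ unitCube d)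
    (hinj : Function.Injective p) {a : ι → ℝ} (ha : a ≠ 0) : 0 < kernelForm θ γ p a := by
  obtain ⟨u, i, hai, hu0, hui, hsum⟩ := exists_sum_orthantFn_eq hp hinj ha
  rw [kernelForm_eq_integral hθ hγ hp]
  have hint : Integrable (fun t => (∑ i, a i * orthantFn (p i) t) ^ 2) (fieldMeasure θ γ) := by
    refine Integrable.of_bound (Measurable.aestronglyMeasurable ?_) ((∑ i, |a i|) ^ 2)
      (.of_forall fun t => ?_)
    · exact (Finset.measurable_sum _ fun i _ => (measurable_orthantFn _).const_mul _).pow_const 2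
    · rw [norm_pow]
      refine pow_le_pow_left₀ (norm_nonneg _) ?_ 2
      refine (norm_sum_le _ _).trans (Finset.sum_le_sum fun i _ => ?_)
      rw [norm_mul]
      exact mul_le_of_le_one_right (norm_nonneg _) (abs_orthantFn_le_one _ _)
  rw [integral_pos_iff_support_of_nonneg (fun t => sq_nonneg _) hint]
  have hpos : 0 < fieldMeasure θ γ (Set.univ.pi fun j => Set.Ioo (u j) (p i j)) := by
    rw [fieldMeasure, Measure.pi_pi]
    exact pos_iff_ne_zero.2 (Finset.prod_ne_zero_iff.2 fun j _ =>
      (coordMeasure_Ioo_pos (hγ j) (hu0 j) (hui j) (hp i j).2).ne')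
  refine hpos.trans_le (measure_mono fun t ht => ?_)
  rw [Function.mem_support, hsum t ht]
  exact pow_ne_zero 2 hai

/-! ### Dyadic approximation of step functions. -/

/-- The point of the dyadic grid of level `l` next below `z`, or the least point of that grid. -/
noncomputable def gridPoint (l : ℕ) (z : ℝ) : ℝ := (max 1 ⌊z * 2 ^ l⌋₊ : ℕ) / 2 ^ l

lemma gridPoint_mem {l : ℕ} (hl : 1 ≤ l) {z : ℝ} (hz : 0 < z ∧ z < 1) :
    gridPoint l z ∈ dyadicGrid l := by
  refine Finset.mem_image.2 ⟨max 1 ⌊z * 2 ^ l⌋₊, Finset.mem_Icc.2 ⟨le_max_left _ _, ?_⟩, rfl⟩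
  have h2 : 2 ≤ 2 ^ l := by simpa using Nat.pow_le_pow_right (n := 2) (by norm_num) hl
  refine max_le (by omega) ?_
  have : ⌊z * 2 ^ l⌋₊ < 2 ^ l := by
    rw [Nat.floor_lt (mul_nonneg hz.1.le (by positivity))]
    push_cast
    exact mul_lt_of_lt_one_left (by positivity) hz.2
  omega

lemma dyadicGrid_subset {l : ℕ} {u : ℝ} (hu : u ∈ dyadicGrid l) : 0 < u ∧ u < 1 := by
  obtain ⟨i, hi, rfl⟩ := Finset.mem_image.1 hu
  rw [Finset.mem_Icc] at hi
  have h1 : (0 : ℝ) < i := by exact_mod_cast hi.1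
  have h2 : (i : ℝ) < 2 ^ l := by
    have : i < 2 ^ l := by have := Nat.one_le_two_pow (n := l); omega
    exact_mod_cast this
  exact ⟨by positivity, by rw [div_lt_one (by positivity)]; exact h2⟩

lemma abs_sub_gridPoint_le (l : ℕ) {z : ℝ} (hz : 0 < z) : |z - gridPoint l z| ≤ (1 / 2) ^ l := by
  have hp : (0 : ℝ) < 2 ^ l := by positivity
  have hf := Nat.floor_le (mul_nonneg hz.le hp.le)
  have hf' := Nat.lt_floor_add_one (z * 2 ^ l)
  have key : |z * 2 ^ l - (max 1 ⌊z * 2 ^ l⌋₊ : ℕ)| ≤ 1 := by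
    have hzp : 0 < z * 2 ^ l := by positivity
    -- Below the first grid point the approximation is from above, still within one mesh width.
    rcases Nat.eq_zero_or_pos ⌊z * 2 ^ l⌋₊ with h | h
    · rw [h] at hf' ⊢
      simp only [Nat.cast_zero, zero_add] at hf'
      rw [abs_le]; simp only [zero_le, sup_of_le_left, Nat.cast_one]; constructor <;> linarith
    · rw [max_eq_right h, abs_le]; constructor <;> linarith
  have : z - gridPoint l z = (z * 2 ^ l - (max 1 ⌊z * 2 ^ l⌋₊ : ℕ)) / 2 ^ l := by
    unfold gridPoint; field_simp
  rw [this, abs_div, abs_of_pos hp, div_le_iff₀ hp]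
  simpa [← mul_pow] using key

/-- The step functions at the successive dyadic approximations of `z`, up to level `τ`, followed by
the step function at `z` itself. -/
noncomputable def levelFn (τ : ℕ) (z : ℝ) (l : ℕ) (t : ℝ) : ℝ :=
  if l = 0 then 0 else if l ≤ τ then stepFn (gridPoint l z) t else stepFn z t

lemma levelFn_succ_of_lt {τ l : ℕ} (h : l < τ) (z : ℝ) :
    levelFn τ z (l + 1) = stepFn (gridPoint (l + 1) z) := by
  ext t; simp [levelFn, h]

lemma measurable_levelFn (τ : ℕ) (z : ℝ) (l : ℕ) : Measurable (levelFn τ z l) := by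
  unfold levelFn
  split_ifs
  exacts [measurable_const, measurable_stepFn _, measurable_stepFn _]

/-- The difference of consecutive approximations. -/
noncomputable def levelDiff (τ : ℕ) (z : ℝ) (l : ℕ) (t : ℝ) : ℝ :=
  levelFn τ z (l + 1) t - levelFn τ z l t

lemma sum_levelDiff (τ : ℕ) (z t : ℝ) :
    ∑ l ∈ Finset.range (τ + 1), levelDiff τ z l t = stepFn z t := by
  have := Finset.sum_range_sub (fun l => levelFn τ z l t) (τ + 1)
  simp only [levelDiff]
  rw [this]; simp [levelFn]

lemma integrable_levelDiff_sq (μ : Measure ℝ) [IsFiniteMeasure μ] (τ : ℕ) (z : ℝ) (l : ℕ) :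
    Integrable (fun t => levelDiff τ z l t ^ 2) μ := by
  refine Integrable.of_bound (((measurable_levelFn τ z _).sub
    (measurable_levelFn τ z _)).pow_const 2).aestronglyMeasurable 1 (.of_forall fun t => ?_)
  have h : ∀ l, 0 ≤ levelFn τ z l t ∧ levelFn τ z l t ≤ 1 := fun l => by
    unfold levelFn
    split_ifs
    exacts [by norm_num, ⟨stepFn_nonneg _ _, stepFn_le_one _ _⟩,
      ⟨stepFn_nonneg _ _, stepFn_le_one _ _⟩]
  rw [norm_pow]
  refine pow_le_one₀ (norm_nonneg _) ?_
  rw [Real.norm_eq_abs, abs_le]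
  constructor <;> unfold levelDiff <;> linarith [h l, h (l + 1)]

lemma integral_stepFn_sub_sq {θ γ : ℝ} (hθ : 0 ≤ θ) (hγ : 0 ≤ γ) {x x' : ℝ}
    (hx : 0 < x ∧ x < 1) (hx' : 0 < x' ∧ x' < 1) :
    ∫ t, (stepFn x t - stepFn x' t) ^ 2 ∂coordMeasure θ γ = γ * |x - x'| := by
  have hi : ∀ y y', Integrable (fun t => stepFn y t * stepFn y' t) (coordMeasure θ γ) :=
    fun y y' => by simp only [stepFn_mul_stepFn]; exact integrable_stepFn _ _
  have h : ∀ t, (stepFn x t - stepFn x' t) ^ 2 =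
      stepFn x t * stepFn x t - 2 * (stepFn x t * stepFn x' t) + stepFn x' t * stepFn x' t :=
    fun t => by ring
  simp only [h]
  rw [integral_add (f := fun t => stepFn x t * stepFn x t - 2 * (stepFn x t * stepFn x' t))
      ((hi _ _).sub ((hi _ _).const_mul 2)) (hi _ _),
    integral_sub (hi _ _) ((hi _ _).const_mul 2), integral_const_mul,
    integral_stepFn_mul hθ hγ hx hx, integral_stepFn_mul hθ hγ hx hx',
    integral_stepFn_mul hθ hγ hx' hx']
  rcases le_total x x' with h | h
  · rw [min_eq_left h, abs_of_nonpos (by linarith)]; simp; ring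
  · rw [min_eq_right h, abs_of_nonneg (by linarith)]; simp; ring

/-- The atom at `0` cancels in a difference of two step functions, leaving `γ` times the distance of
their jumps. Only level `0`, where nothing is subtracted, sees `θ`. -/
lemma integral_levelDiff_sq_le {θ γ : ℝ} (hθ : 0 ≤ θ) (hγ : 0 ≤ γ) {τ : ℕ} (hτ : 1 ≤ τ) {z : ℝ}
    (hz : 0 < z ∧ z < 1) {l : ℕ} (hl : l ≤ τ) :
    ∫ t, levelDiff τ z l t ^ 2 ∂coordMeasure θ γ ≤ (θ + 2 * γ) * (1 / 2) ^ l := by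
  have hpos : (0 : ℝ) ≤ (1 / 2) ^ l := by positivity
  have hmem : ∀ {l}, 1 ≤ l → 0 < gridPoint l z ∧ gridPoint l z < 1 := fun h =>
    dyadicGrid_subset (gridPoint_mem h hz)
  rcases Nat.eq_zero_or_pos l with rfl | h0
  · have : ∀ t, levelDiff τ z 0 t ^ 2 = stepFn (gridPoint 1 z) t * stepFn (gridPoint 1 z) t :=
      fun t => by
        rw [levelDiff, levelFn_succ_of_lt (by omega)]; simp [levelFn, sq]
    simp only [this]
    rw [integral_stepFn_mul hθ hγ (hmem le_rfl) (hmem le_rfl), min_self]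
    have := mul_le_mul_of_nonneg_left (hmem (l := 1) le_rfl).2.le hγ
    simp only [pow_zero, mul_one] at this ⊢; linarith
  obtain ⟨m, rfl⟩ : ∃ m, l = m + 1 := ⟨l - 1, by omega⟩
  have hb := abs_sub_gridPoint_le (m + 1) hz.1
  have hfin : ∀ x : ℝ, |x - gridPoint (m + 1) z| ≤ 2 * (1 / 2) ^ (m + 1) →
      γ * |x - gridPoint (m + 1) z| ≤ (θ + 2 * γ) * (1 / 2) ^ (m + 1) := fun x hx => by
    have := mul_le_mul_of_nonneg_left hx hγ
    nlinarith [mul_nonneg hθ hpos]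
  rcases hl.lt_or_eq with h | h
  · simp only [levelDiff, levelFn_succ_of_lt h, levelFn_succ_of_lt (show m < τ by omega)]
    rw [integral_stepFn_sub_sq hθ hγ (hmem (by omega)) (hmem (by omega))]
    refine hfin _ ?_
    have hb' := abs_sub_gridPoint_le (m + 1 + 1) hz.1
    rw [abs_sub_comm] at hb'
    have := abs_sub_le (gridPoint (m + 1 + 1) z) z (gridPoint (m + 1) z)
    rw [pow_succ] at hb'
    linarith
  · have h1 : levelFn τ z (m + 1 + 1) = stepFn z := by
      ext t; simp [levelFn, show ¬ (m + 1 + 1 ≤ τ) by omega]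
    simp only [levelDiff, h1, levelFn_succ_of_lt (show m < τ by omega)]
    rw [integral_stepFn_sub_sq hθ hγ hz (hmem (by omega))]
    exact hfin _ (by linarith)

/-! ### Counting level vectors and sparse grid points. -/

/-- Once the total is fixed, the last `e` entries determine the first, so at most `m ^ e` vectors
share a total. This is the source of the logarithmic factors. -/
lemma sum_comp_sum_le {e m : ℕ} (T : Finset ℕ) {w : ℕ → ℝ} (hw : ∀ s, 0 ≤ w s)
    {A : Finset (Fin (e + 1) → ℕ)} (hm : ∀ l ∈ A, ∀ j, l j < m) (hA : ∀ l ∈ A, ∑ j, l j ∈ T) :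
    ∑ l ∈ A, w (∑ j, l j) ≤ (m : ℝ) ^ e * ∑ s ∈ T, w s := by
  rw [← Finset.sum_fiberwise_of_maps_to hA, Finset.mul_sum]
  refine Finset.sum_le_sum fun s _ => ?_
  rw [Finset.sum_congr rfl (g := fun _ => w s) fun l hl => by rw [(Finset.mem_filter.1 hl).2],
    Finset.sum_const, nsmul_eq_mul]
  refine mul_le_mul_of_nonneg_right ?_ (hw s)
  have : (A.filter fun l => ∑ j, l j = s).card ≤
      (Fintype.piFinset fun _ : Fin e => Finset.range m).card := by
    refine Finset.card_le_card_of_injOn (fun l => Fin.tail l) (fun l hl => ?_) ?_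
    · simp only [Finset.coe_filter, Set.mem_ofPred_eq] at hl
      simpa [Fin.tail] using fun j => hm l hl.1 _
    · intro l hl l' hl' h
      simp only [Finset.coe_filter, Set.mem_ofPred_eq] at hl hl'
      have h0 : ∀ j : Fin e, l j.succ = l' j.succ := fun j => congrFun h j
      have h1 := hl.2.trans hl'.2.symm
      rw [Fin.sum_univ_succ, Fin.sum_univ_succ, Finset.sum_congr rfl fun j _ => h0 j] at h1
      exact funext (Fin.cases (by omega) h0)
  simpa using (show ((A.filter fun l => ∑ j, l j = s).card : ℝ) ≤ _ from Nat.cast_le.2 this)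

lemma card_dyadicGrid (l : ℕ) : (dyadicGrid l).card = 2 ^ l - 1 := by
  rw [dyadicGrid, Finset.card_image_of_injective, Nat.card_Icc, Nat.add_sub_cancel]
  intro i i' h
  have : (2 : ℝ) ^ l ≠ 0 := by positivity
  simpa [this] using h

lemma card_sparseGrid_le (e τ : ℕ) :
    ((sparseGrid (e + 1) τ).card : ℝ) ≤ (τ + 1 : ℝ) ^ e * 2 ^ (τ + e + 1) := by
  have h1 : ((sparseGrid (e + 1) τ).card : ℝ) ≤
      ∑ l ∈ (Fintype.piFinset fun _ : Fin (e + 1) => Finset.Icc 1 τ).filter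
        fun l => ∑ j, l j ≤ τ + (e + 1) - 1, (2 : ℝ) ^ (∑ j, l j) := by
    have : (sparseGrid (e + 1) τ).card ≤
      ∑ l ∈ (Fintype.piFinset fun _ : Fin (e + 1) => Finset.Icc 1 τ).filter
        fun l => ∑ j, l j ≤ τ + (e + 1) - 1, 2 ^ (∑ j, l j) := by
      refine Finset.card_biUnion_le.trans (Finset.sum_le_sum fun l _ => ?_)
      rw [Fintype.card_piFinset, ← Finset.prod_pow_eq_pow_sum]
      exact Finset.prod_le_prod' fun j _ => by
        rw [card_dyadicGrid]; exact Nat.sub_le _ _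
    exact_mod_cast this
  refine h1.trans ((sum_comp_sum_le (m := τ + 1) (Finset.range (τ + e + 1))
    (w := fun s => (2 : ℝ) ^ s) (fun s => by positivity) (fun l hl j => ?_)
    fun l hl => ?_).trans ?_)
  · have := Fintype.mem_piFinset.1 (Finset.mem_filter.1 hl).1 j
    rw [Finset.mem_Icc] at this; omega
  · have := (Finset.mem_filter.1 hl).2
    rw [Finset.mem_range]; omega
  · push_cast
    refine mul_le_mul_of_nonneg_left ?_ (by positivity)
    rw [geom_sum_eq (by norm_num)]
    norm_num

lemma le_card_sparseGrid (e : ℕ) {τ : ℕ} (hτ : 1 ≤ τ) :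
    2 ^ τ - 1 ≤ (sparseGrid (e + 1) τ).card := by
  -- The full grid refined in one direction only has `2 ^ τ - 1` points.
  let l : Fin (e + 1) → ℕ := Fin.cons τ fun _ => 1
  have hl : l ∈ (Fintype.piFinset fun _ : Fin (e + 1) => Finset.Icc 1 τ).filter
      fun l => ∑ j, l j ≤ τ + (e + 1) - 1 := by
    rw [Finset.mem_filter, Fintype.mem_piFinset]
    refine ⟨fun j => ?_, by simp [l, Fin.sum_univ_succ]⟩
    refine Fin.cases ?_ (fun j => ?_) j <;> simp [l, hτ]
  refine le_trans (le_of_eq ?_)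
    (Finset.card_le_card (Finset.subset_biUnion_of_mem
      (fun l : Fin (e + 1) → ℕ => Fintype.piFinset fun j => dyadicGrid (l j)) hl))
  simp [Fintype.card_piFinset, card_dyadicGrid, Fin.prod_univ_succ, l]

lemma sparseGrid_subset {d τ : ℕ} {p : Fin d → ℝ} (hp : p ∈ sparseGrid d τ) : p ∈ unitCube d := by
  obtain ⟨l, -, h⟩ := Finset.mem_biUnion.1 hp
  exact fun j => dyadicGrid_subset (Fintype.mem_piFinset.1 h j)

/-! ### Sparse grid approximation of features. -/

lemma prod_levelFn_mem_span {d τ : ℕ} {z : Fin d → ℝ} (hz : z ∈ unitCube d) {l : Fin d → ℕ}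
    (hd : 1 ≤ d) (hl : ∑ j, l j ≤ τ + d - 1) :
    (fun t : Fin d → ℝ => ∏ j, levelFn τ (z j) (l j) (t j)) ∈
      Submodule.span ℝ (orthantFn '' (sparseGrid d τ : Set (Fin d → ℝ))) := by
  by_cases h : ∃ j, l j = 0
  · obtain ⟨j, hj⟩ := h
    have : (fun t : Fin d → ℝ => ∏ j, levelFn τ (z j) (l j) (t j)) = 0 := by
      ext t; exact Finset.prod_eq_zero (Finset.mem_univ j) (by simp [hj, levelFn])
    rw [this]; exact Submodule.zero_mem _
  push Not at h
  have h1 : ∀ j, 1 ≤ l j := fun j => Nat.one_le_iff_ne_zero.2 (h j)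
  -- The other `d - 1` levels use up at least `d - 1` of the total `τ + d - 1`.
  have h2 : ∀ j, l j ≤ τ := fun j => by
    have := Finset.add_sum_erase Finset.univ l (Finset.mem_univ j)
    have h3 : (Finset.univ.erase j).card • 1 ≤ ∑ i ∈ Finset.univ.erase j, l i :=
      Finset.card_nsmul_le_sum _ _ _ fun i _ => h1 i
    rw [Finset.card_erase_of_mem (Finset.mem_univ j), Finset.card_univ, Fintype.card_fin] at h3
    simp only [smul_eq_mul, mul_one] at h3
    omega
  refine Submodule.subset_span ⟨fun j => gridPoint (l j) (z j), ?_, ?_⟩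
  · refine Finset.mem_coe.2 (Finset.mem_biUnion.2 ⟨l, ?_, Fintype.mem_piFinset.2 fun j =>
      gridPoint_mem (h1 j) (hz j)⟩)
    exact Finset.mem_filter.2 ⟨Fintype.mem_piFinset.2 fun j => Finset.mem_Icc.2 ⟨h1 j, h2 j⟩, hl⟩
  · ext t
    exact Finset.prod_congr rfl fun j _ => by simp [levelFn, h j, h2 j]

/-- Multiplying out the differences gives products with levels at most `l j + 1`. Their total is at
most `τ - 1 + d`, exactly the sparse grid budget. -/
lemma prod_levelDiff_mem_span {d τ : ℕ} {z : Fin d → ℝ} (hz : z ∈ unitCube d) {l : Fin d → ℕ}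
    (hd : 1 ≤ d) (hl : ∑ j, l j < τ) :
    (fun t : Fin d → ℝ => ∏ j, levelDiff τ (z j) (l j) (t j)) ∈
      Submodule.span ℝ (orthantFn '' (sparseGrid d τ : Set (Fin d → ℝ))) := by
  classical
  have : (fun t : Fin d → ℝ => ∏ j, levelDiff τ (z j) (l j) (t j)) =
      ∑ A : Finset (Fin d), (-1 : ℝ) ^ Aᶜ.card • fun t : Fin d → ℝ =>
        ∏ j, levelFn τ (z j) (if j ∈ A then l j + 1 else l j) (t j) := by
    ext t
    simp only [levelDiff, sub_eq_add_neg, Finset.sum_apply, Pi.smul_apply, smul_eq_mul]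
    rw [Fintype.prod_add]
    refine Finset.sum_congr rfl fun A _ => ?_
    have h1 : ∏ j ∈ A, levelFn τ (z j) (if j ∈ A then l j + 1 else l j) (t j) =
        ∏ j ∈ A, levelFn τ (z j) (l j + 1) (t j) :=
      Finset.prod_congr rfl fun j hj => by rw [if_pos hj]
    have h2 : ∏ j ∈ Aᶜ, levelFn τ (z j) (if j ∈ A then l j + 1 else l j) (t j) =
        ∏ j ∈ Aᶜ, levelFn τ (z j) (l j) (t j) :=
      Finset.prod_congr rfl fun j hj => by rw [if_neg (Finset.mem_compl.1 hj)]
    rw [Finset.prod_neg, ← Finset.prod_mul_prod_compl A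
      (fun j => levelFn τ (z j) (if j ∈ A then l j + 1 else l j) (t j)), h1, h2]
    ring
  rw [this]
  refine Submodule.sum_mem _ fun A _ => Submodule.smul_mem _ _ (prod_levelFn_mem_span hz hd ?_)
  have : ∑ j, (if j ∈ A then l j + 1 else l j) ≤ ∑ j, (l j + 1) :=
    Finset.sum_le_sum fun j _ => by split_ifs <;> omega
  rw [Finset.sum_add_distrib] at this
  simp only [Finset.sum_const, Finset.card_univ, Fintype.card_fin, smul_eq_mul, mul_one] at this
  omega

/-- The sparse grid approximation of the feature of a point. -/
lemma exists_mem_span_integral_sq_le {e τ : ℕ} (hτ : 1 ≤ τ) {θ γ : Fin (e + 1) → ℝ}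
    (hθ : ∀ j, 0 < θ j) (hγ : ∀ j, 0 < γ j) {z : Fin (e + 1) → ℝ} (hz : z ∈ unitCube (e + 1)) :
    ∃ F ∈ Submodule.span ℝ (orthantFn '' (sparseGrid (e + 1) τ : Set (Fin (e + 1) → ℝ))),
      ∫ t, (orthantFn z t - F t) ^ 2 ∂fieldMeasure θ γ ≤ (∏ j, (θ j + 2 * γ j)) *
        ((τ + 1 : ℝ) ^ e * (√(1 / 2) ^ τ / (1 - √(1 / 2)))) ^ 2 := by
  classical
  set r : ℝ := √(1 / 2) with hr
  have hr0 : 0 < r := Real.sqrt_pos.2 (by norm_num)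
  have hr2 : r ^ 2 = 1 / 2 := Real.sq_sqrt (by norm_num)
  have hr1 : r < 1 := by nlinarith
  let P := Fintype.piFinset fun _ : Fin (e + 1) => Finset.range (τ + 1)
  let D : (Fin (e + 1) → ℕ) → (Fin (e + 1) → ℝ) → ℝ :=
    fun l t => ∏ j, levelDiff τ (z j) (l j) (t j)
  let A := P.filter fun l => ¬ ∑ j, l j < τ
  have hC : 0 ≤ ∏ j, (θ j + 2 * γ j) := Finset.prod_nonneg fun j _ => by
    linarith [hθ j, hγ j]
  refine ⟨∑ l ∈ P.filter fun l => ∑ j, l j < τ, D l, Submodule.sum_mem _ fun l hl =>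
    prod_levelDiff_mem_span hz (by omega) (Finset.mem_filter.1 hl).2, ?_⟩
  have hsplit : ∀ t, orthantFn z t - (∑ l ∈ P.filter fun l => ∑ j, l j < τ, D l) t =
      ∑ l ∈ A, D l t := fun t => by
    have : orthantFn z t = ∑ l ∈ P, D l t := by
      simp only [orthantFn, ← sum_levelDiff τ]
      rw [Finset.prod_univ_sum]
    rw [this, ← Finset.sum_filter_add_sum_filter_not P (fun l => ∑ j, l j < τ), Finset.sum_apply]
    ring
  have hDsq : ∀ l t, D l t ^ 2 = ∏ j, levelDiff τ (z j) (l j) (t j) ^ 2 := fun l t =>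
    (Finset.prod_pow _ _ _).symm
  have hDint : ∀ l, Integrable (fun t => D l t ^ 2) (fieldMeasure θ γ) := fun l => by
    simp only [hDsq]
    exact Integrable.fintype_prod fun j => integrable_levelDiff_sq _ _ _ _
  have hDle : ∀ l ∈ A, ∫ t, D l t ^ 2 ∂fieldMeasure θ γ ≤
      (∏ j, (θ j + 2 * γ j)) * (r ^ ∑ j, l j) ^ 2 := fun l hl => by
    simp only [hDsq, fieldMeasure]
    rw [integral_fintype_prod_eq_prod (fun j t => levelDiff τ (z j) (l j) t ^ 2), ← pow_mul,
      mul_comm _ 2, pow_mul, hr2, ← Finset.prod_pow_eq_pow_sum, ← Finset.prod_mul_distrib]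
    refine Finset.prod_le_prod (fun j _ => integral_nonneg fun t => sq_nonneg _) fun j _ => ?_
    refine integral_levelDiff_sq_le (hθ j).le (hγ j).le hτ (hz j) ?_
    have := Fintype.mem_piFinset.1 (Finset.mem_filter.1 hl).1 j
    rw [Finset.mem_range] at this; omega
  have hw : ∀ s : ℕ, 0 < r ^ s := fun s => pow_pos hr0 s
  have hW : ∑ l ∈ A, r ^ (∑ j, l j) ≤ (τ + 1 : ℝ) ^ e * (r ^ τ / (1 - r)) := by
    -- The upper end only has to exceed every total occurring in `A`; the geometric tail bound does
    -- not depend on it.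
    refine (sum_comp_sum_le (m := τ + 1) (Finset.Ico τ (τ + (∑ l ∈ A, ∑ j, l j) + 1))
      (w := fun s => r ^ s) (fun s => (hw s).le) (fun l hl j => ?_) fun l hl => ?_).trans ?_
    · exact Finset.mem_range.1 (Fintype.mem_piFinset.1 (Finset.mem_filter.1 hl).1 j)
    · have h1 := (Finset.mem_filter.1 hl).2
      have h2 := Finset.single_le_sum (f := fun l : Fin (e + 1) → ℕ => ∑ j, l j)
        (fun _ _ => Nat.zero_le _) hl
      rw [Finset.mem_Ico]; omega
    · push_cast
      exact mul_le_mul_of_nonneg_left (geom_sum_Ico_le_of_lt_one hr0.le hr1) (by positivity)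
  have hW0 : 0 ≤ ∑ l ∈ A, r ^ (∑ j, l j) := Finset.sum_nonneg fun l _ => (hw _).le
  simp only [hsplit]
  calc ∫ t, (∑ l ∈ A, D l t) ^ 2 ∂fieldMeasure θ γ
      ≤ ∫ t, (∑ l ∈ A, r ^ (∑ j, l j)) * ∑ l ∈ A, D l t ^ 2 / r ^ (∑ j, l j)
          ∂fieldMeasure θ γ := by
        refine integral_mono_of_nonneg (.of_forall fun t => sq_nonneg _)
          ((integrable_finsetSum _ fun l _ => (hDint l).div_const _).const_mul _)
          (.of_forall fun t => ?_)
        -- Pointwise Cauchy–Schwarz with weights `r ^ |l|`, the sizes of the norms, does the work of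
        -- the triangle inequality in `L²`.
        exact Finset.sum_sq_le_sum_mul_sum_of_sq_le_mul _ (fun l _ => (hw _).le)
          (fun l _ => div_nonneg (sq_nonneg _) (hw _).le)
          fun l _ => (mul_div_cancel₀ _ (hw _).ne').ge
    _ = (∑ l ∈ A, r ^ (∑ j, l j)) *
          ∑ l ∈ A, (∫ t, D l t ^ 2 ∂fieldMeasure θ γ) / r ^ (∑ j, l j) := by
        rw [integral_const_mul, integral_finsetSum _ fun l _ => (hDint l).div_const _]
        simp only [integral_div]
    _ ≤ (∑ l ∈ A, r ^ (∑ j, l j)) *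
          ∑ l ∈ A, (∏ j, (θ j + 2 * γ j)) * r ^ (∑ j, l j) := by
        refine mul_le_mul_of_nonneg_left (Finset.sum_le_sum fun l hl => ?_) hW0
        rw [div_le_iff₀ (hw _), mul_assoc, ← sq]
        exact hDle l hl
    _ = (∏ j, (θ j + 2 * γ j)) * (∑ l ∈ A, r ^ (∑ j, l j)) ^ 2 := by
        rw [← Finset.mul_sum]; ring
    _ ≤ _ := mul_le_mul_of_nonneg_left (pow_le_pow_left₀ hW0 hW 2) hC

/-! ### Lebesgue measure on the open cube. -/

lemma measurableSet_unitCube (d : ℕ) : MeasurableSet (unitCube d) := by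
  have : unitCube d = Set.univ.pi fun _ => Set.Ioo (0 : ℝ) 1 := by ext; simp [unitCube]
  rw [this]; exact .univ_pi fun _ => measurableSet_Ioo

lemma volume_restrict_unitCube (d : ℕ) :
    (volume : Measure (Fin d → ℝ)).restrict (unitCube d) =
      Measure.pi fun _ => volume.restrict (Set.Ioo (0 : ℝ) 1) := by
  have : unitCube d = Set.univ.pi fun _ => Set.Ioo (0 : ℝ) 1 := by ext; simp [unitCube]
  rw [this, volume_pi, Measure.restrict_pi_pi]

instance (d : ℕ) : IsFiniteMeasure ((volume : Measure (Fin d → ℝ)).restrict (unitCube d)) := by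
  rw [volume_restrict_unitCube]; infer_instance

/-! ### Functionals bounded by the kernel norm -/

/-- Finite combinations of values of `e` on the cube are bounded by the kernel norm of the
corresponding combination of point evaluations. -/
def KernelBounded {d : ℕ} (θ γ : Fin d → ℝ) (e : (Fin d → ℝ) → ℝ) : Prop :=
  ∃ M : ℝ, 0 ≤ M ∧ ∀ (n : ℕ) (p : Fin n → Fin d → ℝ) (a : Fin n → ℝ),
    (∀ i, p i ∈ unitCube d) → |∑ i, a i * e (p i)| ≤ M * √(kernelForm θ γ p a)

lemma KernelBounded.congr {d : ℕ} {θ γ : Fin d → ℝ} {e e' : (Fin d → ℝ) → ℝ}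
    (h : KernelBounded θ γ e) (he : ∀ x ∈ unitCube d, e' x = e x) : KernelBounded θ γ e' := by
  obtain ⟨M, hM, h⟩ := h
  refine ⟨M, hM, fun n p a hp => ?_⟩
  simp only [he _ (hp _)]
  exact h n p a hp

lemma KernelBounded.sum {d : ℕ} {θ γ : Fin d → ℝ} {ι : Type*} {s : Finset ι}
    {e : ι → (Fin d → ℝ) → ℝ} (h : ∀ i ∈ s, KernelBounded θ γ (e i)) :
    KernelBounded θ γ fun x => ∑ i ∈ s, e i x := by
  choose! M hM h using h
  refine ⟨∑ i ∈ s, M i, Finset.sum_nonneg hM, fun n p a hp => ?_⟩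
  simp only [Finset.mul_sum]
  rw [Finset.sum_comm, Finset.sum_mul]
  exact (Finset.abs_sum_le_sum_abs _ _).trans (Finset.sum_le_sum fun i hi => h i hi n p a hp)

lemma KernelBounded.const_mul {d : ℕ} {θ γ : Fin d → ℝ} {e : (Fin d → ℝ) → ℝ}
    (h : KernelBounded θ γ e) (c : ℝ) : KernelBounded θ γ fun x => c * e x := by
  obtain ⟨M, hM, h⟩ := h
  refine ⟨|c| * M, by positivity, fun n p a hp => ?_⟩
  simp only [mul_left_comm _ c]
  rw [← Finset.mul_sum, abs_mul, mul_assoc]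
  exact mul_le_mul_of_nonneg_left (h n p a hp) (abs_nonneg c)

lemma abs_integral_mul_le {α : Type*} [MeasurableSpace α] {μ : Measure α} {f g : α → ℝ}
    (hf : MemLp f 2 μ) (hg : MemLp g 2 μ) :
    |∫ t, f t * g t ∂μ| ≤ √(∫ t, f t ^ 2 ∂μ) * √(∫ t, g t ^ 2 ∂μ) := by
  have h2 : ENNReal.ofReal 2 = 2 := by simp
  have := integral_mul_norm_le_Lp_mul_Lq (μ := μ) (f := f) (g := g) Real.HolderConjugate.two_two
    (by rwa [h2]) (by rwa [h2])
  simp only [Real.rpow_two, Real.norm_eq_abs, sq_abs, ← Real.sqrt_eq_rpow] at this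
  refine (abs_integral_le_integral_abs).trans ?_
  simpa only [abs_mul] using this

lemma integral_prod_stepFn_mul {d : ℕ} (B : Finset (Fin d)) {x x' : Fin d → ℝ}
    (hx : x ∈ unitCube d) (hx' : x' ∈ unitCube d) :
    ∫ y in unitCube d, (∏ j ∈ B, stepFn (x j) (y j)) * ∏ j ∈ B, stepFn (x' j) (y j) =
      ∏ j ∈ B, min (x j) (x' j) := by
  classical
  have h : ∀ y : Fin d → ℝ, (∏ j ∈ B, stepFn (x j) (y j)) * ∏ j ∈ B, stepFn (x' j) (y j) =
      ∏ j, (fun (j : Fin d) (t : ℝ) => if j ∈ B then stepFn (min (x j) (x' j)) t else 1) j (y j) :=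
    fun y => by
      rw [← Finset.prod_mul_distrib, Fintype.prod_ite_mem]
      exact Finset.prod_congr rfl fun j _ => stepFn_mul_stepFn _ _ _
  simp only [h]
  rw [volume_restrict_unitCube, integral_fintype_prod_eq_prod
    (fun (j : Fin d) (t : ℝ) => if j ∈ B then stepFn (min (x j) (x' j)) t else 1),
    ← Fintype.prod_ite_mem B]
  refine Finset.prod_congr rfl fun j _ => ?_
  split_ifs with hj
  · exact integral_stepFn_Ioo (lt_min (hx j).1 (hx' j).1) (min_lt_of_left_lt (hx j).2)
  · simp

lemma measurable_prod_stepFn {d : ℕ} (B : Finset (Fin d)) (x : Fin d → ℝ) :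
    Measurable fun y : Fin d → ℝ => ∏ j ∈ B, stepFn (x j) (y j) :=
  Finset.measurable_fun_prod _ fun j _ => (measurable_stepFn _).comp (measurable_pi_apply j)

lemma abs_prod_stepFn_le {d : ℕ} (B : Finset (Fin d)) (x y : Fin d → ℝ) :
    |∏ j ∈ B, stepFn (x j) (y j)| ≤ 1 := by
  rw [Finset.abs_prod]
  exact Finset.prod_le_one (fun _ _ => abs_nonneg _) fun j _ => abs_stepFn_le_one _ _

lemma memLp_sum_prod_stepFn {d : ℕ} (B : Finset (Fin d)) {ι : Type*} [Fintype ι]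
    (p : ι → Fin d → ℝ) (a : ι → ℝ) (q : ENNReal) (μ : Measure (Fin d → ℝ)) [IsFiniteMeasure μ] :
    MemLp (fun y => ∑ i, a i * ∏ j ∈ B, stepFn (p i j) (y j)) q μ := by
  refine MemLp.of_bound (Finset.measurable_fun_sum _ fun i _ =>
    (measurable_prod_stepFn B (p i)).const_mul _).aestronglyMeasurable (∑ i, |a i|)
      (.of_forall fun y => ?_)
  refine (norm_sum_le _ _).trans (Finset.sum_le_sum fun i _ => ?_)
  rw [norm_mul]
  exact mul_le_of_le_one_right (norm_nonneg _) (abs_prod_stepFn_le _ _ _)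

lemma integral_sum_prod_stepFn_sq {d : ℕ} (B : Finset (Fin d)) {ι : Type*} [Fintype ι]
    {p : ι → Fin d → ℝ} (hp : ∀ i, p i ∈ unitCube d) (a : ι → ℝ) :
    ∫ y in unitCube d, (∑ i, a i * ∏ j ∈ B, stepFn (p i j) (y j)) ^ 2 =
      ∑ i, ∑ l, a i * a l * ∏ j ∈ B, min (p i j) (p l j) := by
  have h : ∀ y : Fin d → ℝ, (∑ i, a i * ∏ j ∈ B, stepFn (p i j) (y j)) ^ 2 =
      ∑ i, ∑ l, a i * a l *
        ((∏ j ∈ B, stepFn (p i j) (y j)) * ∏ j ∈ B, stepFn (p l j) (y j)) := fun y => by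
    rw [sq, Finset.sum_mul_sum]
    exact Finset.sum_congr rfl fun i _ => Finset.sum_congr rfl fun l _ => by ring
  have hint : ∀ i l, Integrable (fun y : Fin d → ℝ =>
      (∏ j ∈ B, stepFn (p i j) (y j)) * ∏ j ∈ B, stepFn (p l j) (y j))
      (volume.restrict (unitCube d)) := fun i l =>
    Integrable.of_bound ((measurable_prod_stepFn B _).mul
      (measurable_prod_stepFn B _)).aestronglyMeasurable 1 (.of_forall fun y => by
        rw [norm_mul]
        exact mul_le_one₀ (abs_prod_stepFn_le _ _ _) (norm_nonneg _) (abs_prod_stepFn_le _ _ _))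
  simp only [h]
  rw [integral_finsetSum _ fun i _ => integrable_finsetSum _ fun l _ => (hint i l).const_mul _]
  refine Finset.sum_congr rfl fun i _ => ?_
  rw [integral_finsetSum _ fun l _ => (hint i l).const_mul _]
  refine Finset.sum_congr rfl fun l _ => ?_
  rw [integral_const_mul, integral_prod_stepFn_mul B (hp i) (hp l)]

/-- Expanding the product kernel over subsets splits the form into nonnegative terms with positive
weights when all `θ j` and `γ j` are positive, so the form then controls each of them separately. -/
lemma kernelForm_eq_sum {d : ℕ} {ι : Type*} [Fintype ι] (θ γ : Fin d → ℝ)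
    {p : ι → Fin d → ℝ} (hp : ∀ i, p i ∈ unitCube d) (a : ι → ℝ) :
    kernelForm θ γ p a = ∑ B : Finset (Fin d), ((∏ j ∈ Bᶜ, θ j) * ∏ j ∈ B, γ j) *
      ∫ y in unitCube d, (∑ i, a i * ∏ j ∈ B, stepFn (p i j) (y j)) ^ 2 := by
  have h : ∀ i l, bfKernel θ γ (p i) (p l) = ∑ B : Finset (Fin d),
      ((∏ j ∈ Bᶜ, θ j) * ∏ j ∈ B, γ j) * ∏ j ∈ B, min (p i j) (p l j) := fun i l => by
    simp only [bfKernel, add_comm (θ _)]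
    rw [Fintype.prod_add]
    exact Finset.sum_congr rfl fun B _ => by rw [Finset.prod_mul_distrib]; ring
  simp only [integral_sum_prod_stepFn_sq _ hp, kernelForm, h, Finset.mul_sum]
  symm
  rw [Finset.sum_comm]
  refine Finset.sum_congr rfl fun i _ => ?_
  rw [Finset.sum_comm]
  exact Finset.sum_congr rfl fun l _ => Finset.sum_congr rfl fun B _ => by ring

/-- A combination of such values is the pairing of `G` with a combination of step products.
Cauchy–Schwarz applies, and the norm of the latter is controlled by the `B`-term of the kernel form.
-/
lemma kernelBounded_integral {d : ℕ} {θ γ : Fin d → ℝ} (hθ : ∀ j, 0 < θ j) (hγ : ∀ j, 0 < γ j)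
    (B : Finset (Fin d)) {G : (Fin d → ℝ) → ℝ} (hG : MemLp G 2 (volume.restrict (unitCube d))) :
    KernelBounded θ γ fun x => ∫ y in unitCube d, G y * ∏ j ∈ B, stepFn (x j) (y j) := by
  have hc : ∀ B : Finset (Fin d), 0 < (∏ j ∈ Bᶜ, θ j) * ∏ j ∈ B, γ j := fun B =>
    mul_pos (Finset.prod_pos fun j _ => hθ j) (Finset.prod_pos fun j _ => hγ j)
  set c := (∏ j ∈ Bᶜ, θ j) * ∏ j ∈ B, γ j with hcdef
  have hc0 : 0 < c := hc B
  refine ⟨√(∫ y in unitCube d, G y ^ 2) * (√c)⁻¹, by positivity, fun n p a hp => ?_⟩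
  have hle : c * ∫ y in unitCube d, (∑ i, a i * ∏ j ∈ B, stepFn (p i j) (y j)) ^ 2 ≤
      kernelForm θ γ p a := by
    rw [kernelForm_eq_sum θ γ hp]
    exact Finset.single_le_sum (f := fun B : Finset (Fin d) => ((∏ j ∈ Bᶜ, θ j) * ∏ j ∈ B, γ j) *
      ∫ y in unitCube d, (∑ i, a i * ∏ j ∈ B, stepFn (p i j) (y j)) ^ 2)
      (fun B _ => mul_nonneg (hc B).le (integral_nonneg fun y => sq_nonneg _)) (Finset.mem_univ B)
  have heq : ∑ i, a i * ∫ y in unitCube d, G y * ∏ j ∈ B, stepFn (p i j) (y j) =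
      ∫ y in unitCube d, G y * ∑ i, a i * ∏ j ∈ B, stepFn (p i j) (y j) := by
    simp only [Finset.mul_sum, ← integral_const_mul]
    rw [← integral_finsetSum]
    · exact integral_congr_ae (.of_forall fun y => Finset.sum_congr rfl fun i _ => by ring)
    · intro i _
      exact ((hG.integrable (by norm_num)).mul_bdd
        (measurable_prod_stepFn B _).aestronglyMeasurable
        (.of_forall fun y => abs_prod_stepFn_le B _ _)).const_mul _
  rw [heq, mul_assoc]
  refine (abs_integral_mul_le hG (memLp_sum_prod_stepFn B p a 2 _)).trans
    (mul_le_mul_of_nonneg_left ?_ (Real.sqrt_nonneg _))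
  rw [← Real.sqrt_inv, ← Real.sqrt_mul (by positivity)]
  exact Real.sqrt_le_sqrt (by rw [inv_mul_eq_div, le_div_iff₀ hc0, mul_comm]; exact hle)

/-! ### Test functions of product form -/

lemma exists_bump {a b : ℝ} (hab : a < b) : ∃ ρ : ℝ → ℝ, ContDiff ℝ ∞ ρ ∧ (∀ t, 0 ≤ ρ t) ∧
    ∫ t, ρ t = 1 ∧ ∀ t, t ∉ Set.Ioo a b → ρ t = 0 := by
  let φ : ContDiffBump ((a + b) / 2) := ⟨(b - a) / 4, (b - a) / 2, by linarith, by linarith⟩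
  refine ⟨φ.normed volume, φ.contDiff_normed, φ.nonneg_normed, φ.integral_normed, fun t ht => ?_⟩
  by_contra h
  have : t ∈ Function.support (φ.normed volume) := h
  rw [φ.support_normed_eq, Real.ball_eq_Ioo] at this
  refine ht ⟨?_, ?_⟩
  · have := this.1; simp only [φ] at this; linarith
  · have := this.2; simp only [φ] at this; linarith

/-- The primitive of `ρ` that vanishes at `-∞`. -/
noncomputable def primitive (ρ : ℝ → ℝ) (y : ℝ) : ℝ := ∫ t in Set.Iic y, ρ t

section primitive
variable {ρ : ℝ → ℝ} {a b : ℝ}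

lemma integrable_of_zero_off_Ioo (hc : Continuous ρ) (h0 : ∀ t, t ∉ Set.Ioo a b → ρ t = 0) :
    Integrable ρ :=
  hc.integrable_of_hasCompactSupport (HasCompactSupport.intro (isCompact_Icc (a := a) (b := b))
    fun t ht => h0 t fun h => ht (Set.Ioo_subset_Icc_self h))

lemma primitive_eq_zero (h0 : ∀ t, t ∉ Set.Ioo a b → ρ t = 0) {y : ℝ} (hy : y ≤ a) :
    primitive ρ y = 0 :=
  setIntegral_eq_zero_of_forall_eq_zero fun t ht => h0 t fun h => absurd h.1 (by
    have : t ≤ y := ht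
    linarith)

lemma primitive_eq_integral (h0 : ∀ t, t ∉ Set.Ioo a b → ρ t = 0) {y : ℝ} (hy : b ≤ y) :
    primitive ρ y = ∫ t, ρ t :=
  setIntegral_eq_integral_of_forall_compl_eq_zero fun t ht => h0 t fun h => ht (by
    have := h.2
    simp only [Set.mem_Iic]; linarith)

lemma primitive_mem_Icc (hc : Continuous ρ) (h0 : ∀ t, t ∉ Set.Ioo a b → ρ t = 0)
    (hnn : ∀ t, 0 ≤ ρ t) (h1 : ∫ t, ρ t = 1) (y : ℝ) : 0 ≤ primitive ρ y ∧ primitive ρ y ≤ 1 :=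
  ⟨integral_nonneg hnn, h1 ▸ setIntegral_le_integral (integrable_of_zero_off_Ioo hc h0)
    (.of_forall hnn)⟩

lemma hasDerivAt_primitive (hc : Continuous ρ) (h0 : ∀ t, t ∉ Set.Ioo a b → ρ t = 0) (y : ℝ) :
    HasDerivAt (primitive ρ) (ρ y) y := by
  have hi := integrable_of_zero_off_Ioo hc h0
  have : primitive ρ = fun y => primitive ρ 0 + ∫ t in (0 : ℝ)..y, ρ t := by
    ext y
    rw [← intervalIntegral.integral_Iic_sub_Iic hi.integrableOn hi.integrableOn]
    simp [primitive]
  rw [this]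
  exact (intervalIntegral.integral_hasDerivAt_right (hc.intervalIntegrable _ _)
    (hc.stronglyMeasurableAtFilter _ _) hc.continuousAt).const_add _

end primitive

lemma partialDeriv_prod {d : ℕ} {v : Fin d → ℝ → ℝ} (hv : ∀ j, Differentiable ℝ (v j))
    (i : Fin d) : partialDeriv i (fun y => ∏ j, v j (y j)) =
      fun y => ∏ j, (if j = i then deriv (v j) else v j) (y j) := by
  classical
  ext y
  have h : ∀ j ∈ Finset.univ, HasFDerivAt (fun y : Fin d → ℝ => v j (y j))
      (deriv (v j) (y j) • ContinuousLinearMap.proj (R := ℝ) (φ := fun _ : Fin d => ℝ) j) y :=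
    fun j _ => (hv j (y j)).hasDerivAt.comp_hasFDerivAt y (hasFDerivAt_apply j y)
  rw [partialDeriv, (HasFDerivAt.finsetProd h).fderiv, sum_apply,
    Finset.sum_eq_single i]
  · rw [← Finset.mul_prod_erase _ _ (Finset.mem_univ i)]
    simp only [smul_apply, ContinuousLinearMap.proj_apply, Pi.single_eq_same,
      smul_eq_mul, mul_one, if_true]
    rw [mul_comm]
    congr 1
    exact Finset.prod_congr rfl fun j hj => by rw [if_neg (Finset.ne_of_mem_erase hj)]
  · intro j _ hj
    simp [hj]
  · simp

lemma foldr_partialDeriv_prod {d : ℕ} {v : Fin d → ℝ → ℝ} (hv : ∀ j, ContDiff ℝ ∞ (v j))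
    {L : List (Fin d)} (hL : L.Nodup) :
    L.foldr partialDeriv (fun y => ∏ j, v j (y j)) =
      fun y => ∏ j, (if j ∈ L then deriv (v j) else v j) (y j) := by
  induction L with
  | nil => simp
  | cons i L ih =>
    rw [List.nodup_cons] at hL
    rw [List.foldr_cons, ih hL.2, partialDeriv_prod]
    · ext y
      refine Finset.prod_congr rfl fun j _ => ?_
      by_cases hj : j = i
      · subst hj; simp [hL.1]
      · simp [hj]
    · intro j
      split_ifs
      · exact ((contDiff_infty_iff_deriv.1 (hv j)).2).differentiable (by simp)
      · exact (hv j).differentiable (by simp)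

lemma mixedPartial_prod {d : ℕ} {v : Fin d → ℝ → ℝ} (hv : ∀ j, ContDiff ℝ ∞ (v j))
    (S : Finset (Fin d)) : mixedPartial S (fun y => ∏ j, v j (y j)) =
      fun y => ∏ j, (if j ∈ S then deriv (v j) else v j) (y j) := by
  rw [mixedPartial, foldr_partialDeriv_prod hv (Finset.sort_nodup _ _)]
  simp only [Finset.mem_sort]

lemma IsWeakMixedPartial.integral_prod {d : ℕ} {S : Finset (Fin d)} {f g : (Fin d → ℝ) → ℝ}
    (h : IsWeakMixedPartial S f g) {v : Fin d → ℝ → ℝ} (hv : ∀ j, ContDiff ℝ ∞ (v j))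
    {a b : Fin d → ℝ} (ha : ∀ j, 0 < a j) (hb : ∀ j, b j < 1)
    (h0 : ∀ j t, t ∉ Set.Icc (a j) (b j) → v j t = 0) :
    ∫ y in unitCube d, f y * ∏ j, (if j ∈ S then deriv (v j) else v j) (y j) =
      (-1) ^ S.card * ∫ y in unitCube d, g y * ∏ j, v j (y j) := by
  have hsub : Function.support (fun y : Fin d → ℝ => ∏ j, v j (y j)) ⊆ Set.Icc a b := by
    intro y hy
    have : ∀ j, y j ∈ Set.Icc (a j) (b j) := fun j => by
      by_contra h
      exact hy (Finset.prod_eq_zero (Finset.mem_univ j) (h0 j _ h))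
    exact ⟨fun j => (this j).1, fun j => (this j).2⟩
  have := h (fun y => ∏ j, v j (y j))
    (contDiff_prod fun j _ => (hv j).comp (contDiff_apply ℝ ℝ j))
    (HasCompactSupport.of_support_subset_isCompact isCompact_Icc hsub)
    ((closure_minimal hsub isClosed_Icc).trans fun y hy j =>
      ⟨(ha j).trans_le (hy.1 j), (hy.2 j).trans_lt (hb j)⟩)
  rwa [mixedPartial_prod hv] at this

/-! ### Integral representation of mixed Sobolev functions. -/

lemma abs_prod_comp_le {d : ℕ} {u : Fin d → ℝ → ℝ} {B : Fin d → ℝ} (hB : ∀ j t, |u j t| ≤ B j)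
    (y : Fin d → ℝ) : |∏ j, u j (y j)| ≤ ∏ j, B j := by
  rw [Finset.abs_prod]
  exact Finset.prod_le_prod (fun j _ => abs_nonneg _) fun j _ => hB j _

lemma measurable_prod_comp {d : ℕ} {u : Fin d → ℝ → ℝ} (hu : ∀ j, Measurable (u j)) :
    Measurable fun y : Fin d → ℝ => ∏ j, u j (y j) :=
  Finset.measurable_fun_prod _ fun j _ => (hu j).comp (measurable_pi_apply j)

lemma integrable_mul_prod {d : ℕ} {μ : Measure (Fin d → ℝ)} {f : (Fin d → ℝ) → ℝ}
    (hf : Integrable f μ) {u : Fin d → ℝ → ℝ} (hu : ∀ j, Measurable (u j)) {B : Fin d → ℝ}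
    (hB : ∀ j t, |u j t| ≤ B j) : Integrable (fun y => f y * ∏ j, u j (y j)) μ :=
  hf.mul_bdd (measurable_prod_comp hu).aestronglyMeasurable (.of_forall (abs_prod_comp_le hB))

lemma exists_abs_le_of_zero_off_Ioo {w : ℝ → ℝ} {a b : ℝ} (hc : Continuous w)
    (h0 : ∀ t, t ∉ Set.Ioo a b → w t = 0) : ∃ B, 1 ≤ B ∧ ∀ t, |w t| ≤ B := by
  obtain ⟨B, hB⟩ := (HasCompactSupport.intro (isCompact_Icc (a := a) (b := b))
    fun t ht => h0 t fun h => ht (Set.Ioo_subset_Icc_self h)).exists_bound_of_continuous hc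
  exact ⟨max 1 B, le_max_left _ _, fun t => (hB t).trans (le_max_right _ _)⟩

/-- Write `ρ j = (ρ j - w) + w` and multiply out. As `ρ j - w` has mean zero, its primitive has
compact support in `(0,1)`; the products are thus admissible test functions and no boundary terms
arise. -/
lemma integral_mul_prod_bump {d : ℕ} {f : (Fin d → ℝ) → ℝ}
    (hf : Integrable f (volume.restrict (unitCube d))) {g : Finset (Fin d) → (Fin d → ℝ) → ℝ}
    (hg : ∀ S, IsWeakMixedPartial S f (g S)) {w : ℝ → ℝ} {p q : ℝ} (hp : 0 < p) (hq : q < 1)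
    (hw : ContDiff ℝ ∞ w) (hw1 : ∫ t, w t = 1) (hw0 : ∀ t, t ∉ Set.Ioo p q → w t = 0)
    {ρ : Fin d → ℝ → ℝ} {a b : Fin d → ℝ} (ha : ∀ j, 0 < a j) (hb : ∀ j, b j < 1)
    (hρ : ∀ j, ContDiff ℝ ∞ (ρ j)) (hρ1 : ∀ j, ∫ t, ρ j t = 1)
    (hρ0 : ∀ j t, t ∉ Set.Ioo (a j) (b j) → ρ j t = 0) :
    ∫ y in unitCube d, f y * ∏ j, ρ j (y j) = ∑ S : Finset (Fin d), (-1) ^ S.card *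
      ∫ y in unitCube d, g S y *
        ∏ j, (if j ∈ S then primitive (ρ j) (y j) - primitive w (y j) else w (y j)) := by
  classical
  have hd : ∀ j, deriv (fun t => primitive (ρ j) t - primitive w t) = fun t => ρ j t - w t :=
    fun j => funext fun t => ((hasDerivAt_primitive (hρ j).continuous (hρ0 j) t).sub
      (hasDerivAt_primitive hw.continuous hw0 t)).deriv
  have hsmooth : ∀ j, ContDiff ℝ ∞ (fun t => primitive (ρ j) t - primitive w t) := fun j =>
    contDiff_infty_iff_deriv.2 ⟨fun t => ((hasDerivAt_primitive (hρ j).continuous (hρ0 j) t).sub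
      (hasDerivAt_primitive hw.continuous hw0 t)).differentiableAt, by
        rw [hd]; exact (hρ j).sub hw⟩
  have key : ∀ S : Finset (Fin d), (-1) ^ S.card * ∫ y in unitCube d, g S y *
        ∏ j, (if j ∈ S then primitive (ρ j) (y j) - primitive w (y j) else w (y j)) =
      ∫ y in unitCube d, f y * ∏ j, (if j ∈ S then ρ j (y j) - w (y j) else w (y j)) := fun S => by
    have := (hg S).integral_prod
      (v := fun j => if j ∈ S then fun t => primitive (ρ j) t - primitive w t else w)
      (fun j => by split_ifs; exacts [hsmooth j, hw]) (a := fun j => min (a j) p)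
      (b := fun j => max (b j) q) (fun j => lt_min (ha j) hp) (fun j => max_lt (hb j) hq)
      (fun j t ht => by
        have ht' : t < min (a j) p ∨ max (b j) q < t := by
          by_contra! h; exact ht h
        have hwt : w t = 0 := hw0 t fun h => by
          rcases ht' with h' | h'
          · exact absurd h.1 (h'.trans_le (min_le_right _ _)).le.not_gt
          · exact absurd h.2 ((le_max_right _ _).trans_lt h').le.not_gt
        split_ifs
        · rcases ht' with h' | h'
          · simp only
            rw [primitive_eq_zero (hρ0 j) (h'.le.trans (min_le_left _ _)),
              primitive_eq_zero hw0 (h'.le.trans (min_le_right _ _)), sub_zero]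
          -- To the right of both supports the two primitives have reached their common total mass
          -- `1`.
          · simp only
            rw [primitive_eq_integral (hρ0 j) ((le_max_left _ _).trans h'.le),
              primitive_eq_integral hw0 ((le_max_right _ _).trans h'.le), hρ1, hw1, sub_self]
        · exact hwt)
    refine Eq.trans ?_ (this.symm.trans ?_)
    · refine congrArg _ (integral_congr_ae (.of_forall fun y => congrArg _ ?_))
      exact Finset.prod_congr rfl fun j _ => by split_ifs <;> rfl
    · refine integral_congr_ae (.of_forall fun y => congrArg _ ?_)
      refine Finset.prod_congr rfl fun j _ => ?_
      split_ifs
      · simp [hd]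
      · rfl
  obtain ⟨Bw, hBw1, hBw⟩ := exists_abs_le_of_zero_off_Ioo hw.continuous hw0
  choose Bρ hBρ1 hBρ using fun j => exists_abs_le_of_zero_off_Ioo (hρ j).continuous (hρ0 j)
  simp only [key]
  rw [← integral_finsetSum]
  · refine integral_congr_ae (.of_forall fun y => ?_)
    simp only
    rw [← Finset.mul_sum]
    congr 1
    have h1 : ∀ j, ρ j (y j) = (ρ j (y j) - w (y j)) + w (y j) := fun j => by ring
    rw [Finset.prod_congr rfl fun j _ => h1 j, Fintype.prod_add]
    refine Finset.sum_congr rfl fun S _ => ?_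
    rw [← Finset.prod_mul_prod_compl S]
    refine congrArg₂ _ (Finset.prod_congr rfl fun j hj => ?_) (Finset.prod_congr rfl fun j hj => ?_)
    · rw [if_pos hj]
    · rw [if_neg (Finset.mem_compl.1 hj)]
  · intro S _
    refine integrable_mul_prod hf (u := fun j t => if j ∈ S then ρ j t - w t else w t)
      (B := fun j => Bρ j + Bw) (fun j => ?_) fun j t => ?_
    · have h1 := (hρ j).continuous.measurable
      have h2 := hw.continuous.measurable
      by_cases hj : j ∈ S <;> simp only [hj, if_true, if_false]
      exacts [h1.sub h2, h2]
    · split_ifs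
      · exact (abs_sub _ _).trans (add_le_add (hBρ j t) (hBw t))
      · linarith [hBw t, hBρ1 j]

/-- A continuous function is the limit of its averages against product bumps shrinking to `x`. -/
lemma tendsto_integral_mul_prod_bump {d : ℕ} {f : (Fin d → ℝ) → ℝ}
    (hf : Integrable f (volume.restrict (unitCube d))) (hcont : ContinuousOn f (unitCube d))
    {x : Fin d → ℝ} (hx : x ∈ unitCube d) {ρ : ℕ → Fin d → ℝ → ℝ} {b : ℕ → Fin d → ℝ}
    (hb : ∀ n j, b n j < 1) (hbx : ∀ j, Filter.Tendsto (fun n => b n j) Filter.atTop (nhds (x j)))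
    (hρ : ∀ n j, Continuous (ρ n j)) (hnn : ∀ n j t, 0 ≤ ρ n j t) (hρ1 : ∀ n j, ∫ t, ρ n j t = 1)
    (hρ0 : ∀ n j t, t ∉ Set.Ioo (x j) (b n j) → ρ n j t = 0) :
    Filter.Tendsto (fun n => ∫ y in unitCube d, f y * ∏ j, ρ n j (y j)) Filter.atTop
      (nhds (f x)) := by
  have hmeas := measurableSet_unitCube d
  have := tendsto_setIntegral_peak_smul_of_integrableOn_of_tendsto (μ := volume) (l := Filter.atTop)
    (g := f) (x₀ := x) (a := f x) (φ := fun n y => ∏ j, ρ n j (y j)) hmeas hmeas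
    subset_rfl self_mem_nhdsWithin
    (by
      have := measure_lt_top ((volume : Measure (Fin d → ℝ)).restrict (unitCube d)) Set.univ
      rw [Measure.restrict_apply_univ] at this
      exact this.ne)
    (.of_forall fun n y _ => Finset.prod_nonneg fun j _ => hnn n j _) ?_ ?_
    (.of_forall fun n => (measurable_prod_comp fun j =>
      (hρ n j).measurable).aestronglyMeasurable) hf (hcont x hx)
  · simpa only [smul_eq_mul, mul_comm] using this
  · intro u hu hxu
    obtain ⟨ε, hε, hball⟩ := Metric.isOpen_iff.1 hu x hxu
    have hev : ∀ᶠ n in Filter.atTop, ∀ j, b n j < x j + ε :=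
      Filter.eventually_all.2 fun j => (hbx j).eventually (gt_mem_nhds (by linarith))
    refine Metric.tendstoUniformlyOn_iff.2 fun δ hδ => ?_
    -- Once the supports lie in the ball around `x`, the product bump is identically zero outside
    -- it.
    filter_upwards [hev] with n hn y hy
    have : ∏ j, ρ n j (y j) = 0 := by
      by_contra h
      replace h := Finset.prod_ne_zero_iff.1 h
      refine hy.2 (hball ((dist_pi_lt_iff hε).2 fun j => ?_))
      have : y j ∈ Set.Ioo (x j) (b n j) := by
        by_contra h'
        exact h j (Finset.mem_univ j) (hρ0 n j _ h')
      rw [Real.dist_eq, abs_of_pos (by linarith [this.1])]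
      linarith [this.2, hn j]
    simpa [this] using hδ
  · refine tendsto_const_nhds.congr fun n => ?_
    rw [volume_restrict_unitCube, integral_fintype_prod_eq_prod]
    refine (Finset.prod_eq_one fun j _ => ?_).symm
    refine Eq.trans ?_ (hρ1 n j)
    refine setIntegral_eq_integral_of_forall_compl_eq_zero fun t ht => hρ0 n j t fun h => ht ?_
    exact ⟨(hx j).1.trans h.1, h.2.trans (hb n j)⟩

/-- The integral representation of a continuous function with weak mixed derivatives. -/
lemma eq_sum_integral_weakMixedPartial {d : ℕ} {f : (Fin d → ℝ) → ℝ}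
    (hf : Integrable f (volume.restrict (unitCube d))) (hcont : ContinuousOn f (unitCube d))
    {g : Finset (Fin d) → (Fin d → ℝ) → ℝ} (hg : ∀ S, IsWeakMixedPartial S f (g S))
    (hgint : ∀ S, Integrable (g S) (volume.restrict (unitCube d)))
    {w : ℝ → ℝ} {p q : ℝ} (hp : 0 < p) (hq : q < 1)
    (hw : ContDiff ℝ ∞ w) (hwnn : ∀ t, 0 ≤ w t) (hw1 : ∫ t, w t = 1)
    (hw0 : ∀ t, t ∉ Set.Ioo p q → w t = 0) {x : Fin d → ℝ} (hx : x ∈ unitCube d) :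
    f x = ∑ S : Finset (Fin d), (-1) ^ S.card * ∫ y in unitCube d, g S y *
      ∏ j, (if j ∈ S then 1 - stepFn (x j) (y j) - primitive w (y j) else w (y j)) := by
  classical
  -- The bumps live on `(x j, b n j)`, strictly right of `x j`; the `+ 2` keeps `b n j` below `1`
  -- even at `n = 0`.
  let b : ℕ → Fin d → ℝ := fun n j => x j + (1 - x j) * (1 / ((n : ℝ) + 2))
  have h2 : ∀ n : ℕ, 0 < 1 / ((n : ℝ) + 2) ∧ 1 / ((n : ℝ) + 2) < 1 := fun n => by
    have : (0 : ℝ) ≤ n := n.cast_nonneg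
    exact ⟨by positivity, by rw [div_lt_one (by positivity)]; linarith⟩
  have hb : ∀ n j, b n j < 1 := fun n j => by
    have := mul_lt_mul_of_pos_left (h2 n).2 (sub_pos.2 (hx j).2)
    simp only [b]; linarith
  have hxb : ∀ n j, x j < b n j := fun n j => by
    have := mul_pos (sub_pos.2 (hx j).2) (h2 n).1
    simp only [b]; linarith
  have hbx : ∀ j, Filter.Tendsto (fun n => b n j) Filter.atTop (nhds (x j)) := fun j => by
    have h : Filter.Tendsto (fun n : ℕ => 1 / ((n : ℝ) + 2)) Filter.atTop (nhds 0) :=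
      (tendsto_const_nhds (x := (1 : ℝ))).div_atTop
        (Filter.tendsto_atTop_add_const_right _ _ tendsto_natCast_atTop_atTop)
    simpa [b] using (h.const_mul (1 - x j)).const_add (x j)
  choose ρ hρ hρnn hρ1 hρ0 using fun n j => exists_bump (hxb n j)
  refine tendsto_nhds_unique (tendsto_integral_mul_prod_bump hf hcont hx hb hbx
    (fun n j => (hρ n j).continuous) hρnn hρ1 hρ0) ?_
  simp only [fun n => integral_mul_prod_bump hf hg hp hq hw hw1 hw0 (fun j => (hx j).1) (hb n)
    (hρ n) (hρ1 n) (hρ0 n)]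
  refine tendsto_finsetSum _ fun S _ => Filter.Tendsto.const_mul _ ?_
  obtain ⟨B, hB1, hB⟩ := exists_abs_le_of_zero_off_Ioo hw.continuous hw0
  have hpm : ∀ {ρ : ℝ → ℝ} {a b : ℝ}, Continuous ρ → (∀ t, t ∉ Set.Ioo a b → ρ t = 0) →
      Measurable (primitive ρ) := fun h h' =>
    (Differentiable.continuous fun t => (hasDerivAt_primitive h h' t).differentiableAt).measurable
  have hmeas : ∀ n j, Measurable fun t =>
      if j ∈ S then primitive (ρ n j) t - primitive w t else w t := fun n j => by
    have h1 := hpm (hρ n j).continuous (hρ0 n j)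
    have h2 := hpm hw.continuous hw0
    by_cases hj : j ∈ S <;> simp only [hj, if_true, if_false]
    exacts [h1.sub h2, hw.continuous.measurable]
  have hbd : ∀ n j t, |if j ∈ S then primitive (ρ n j) t - primitive w t else w t| ≤ B :=
    fun n j t => by
      split_ifs
      · have h1 := primitive_mem_Icc (hρ n j).continuous (hρ0 n j) (hρnn n j) (hρ1 n j) t
        have h2 := primitive_mem_Icc hw.continuous hw0 hwnn hw1 t
        rw [abs_le]; constructor <;> linarith
      · exact hB t
  refine tendsto_integral_of_dominated_convergence (fun y => |g S y| * ∏ _j : Fin d, B)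
    (fun n => (integrable_mul_prod (hgint S) (hmeas n) (hbd n)).aestronglyMeasurable)
    ((hgint S).abs.mul_const _) (fun n => .of_forall fun y => ?_) (.of_forall fun y => ?_)
  · rw [norm_mul]
    exact mul_le_mul_of_nonneg_left (abs_prod_comp_le (hbd n) y) (abs_nonneg _)
  · refine Filter.Tendsto.const_mul _ (tendsto_finsetProd _ fun j _ => ?_)
    split_ifs
    · refine Filter.Tendsto.sub_const ?_ _
      refine tendsto_const_nhds.congr' ?_
      -- The primitives tend to the indicator of `t > x j` at every point, including `t = x j`,
      -- because the bumps approach from the right.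
      by_cases h : y j ≤ x j
      · refine .of_forall fun n => ?_
        simp only [primitive_eq_zero (hρ0 n j) h]; simp [stepFn, h]
      · filter_upwards [(hbx j).eventually (gt_mem_nhds (not_le.1 h))] with n hn
        rw [primitive_eq_integral (hρ0 n j) hn.le, hρ1]; simp [stepFn, h]
    · exact tendsto_const_nhds

/-- Functions in the Sobolev space with dominating mixed smoothness lie in the native space of the
Brownian field kernel. -/
theorem MemHMixOne.kernelBounded {d : ℕ} {θ γ : Fin d → ℝ} (hθ : ∀ j, 0 < θ j)
    (hγ : ∀ j, 0 < γ j) {f : (Fin d → ℝ) → ℝ} (hf : MemHMixOne f)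
    (hcont : ContinuousOn f (unitCube d)) : KernelBounded θ γ f := by
  classical
  choose g hg2 hg using hf.2
  obtain ⟨w, hw, hwnn, hw1, hw0⟩ := exists_bump (show (1 / 4 : ℝ) < 3 / 4 by norm_num)
  obtain ⟨B, hB1, hB⟩ := exists_abs_le_of_zero_off_Ioo hw.continuous hw0
  have hpm : Measurable (primitive w) := (Differentiable.continuous fun t =>
    (hasDerivAt_primitive hw.continuous hw0 t).differentiableAt).measurable
  refine KernelBounded.congr (e := fun x => ∑ S : Finset (Fin d), (-1) ^ S.card *
    ∫ y in unitCube d, g S y *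
      ∏ j, (if j ∈ S then 1 - stepFn (x j) (y j) - primitive w (y j) else w (y j))) ?_
    fun x hx => eq_sum_integral_weakMixedPartial (hf.1.integrable (by norm_num)) hcont hg
      (fun S => (hg2 S).integrable (by norm_num)) (by norm_num) (by norm_num) hw hwnn hw1 hw0 hx
  refine KernelBounded.sum fun S _ => KernelBounded.const_mul ?_ _
  -- Each factor is affine in the step function; `A` collects the coordinates where the step term is
  -- chosen. The coefficient `0` removes every `A` not contained in `S`.
  let h : Finset (Fin d) → Fin d → ℝ → ℝ := fun A j t =>
    if j ∈ A then (if j ∈ S then -1 else 0) else if j ∈ S then 1 - primitive w t else w t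
  have hmeas : ∀ A j, Measurable (h A j) := fun A j => by
    by_cases h1 : j ∈ A <;> by_cases h2 : j ∈ S <;> simp only [h, h1, h2, if_true, if_false]
    exacts [measurable_const, measurable_const, measurable_const.sub hpm, hw.continuous.measurable]
  have hbd : ∀ A j t, |h A j t| ≤ B := fun A j t => by
    have h2 := primitive_mem_Icc hw.continuous hw0 hwnn hw1 t
    simp only [h]
    split_ifs
    · simpa using hB1
    · simpa using zero_le_one.trans hB1
    · rw [abs_le]; constructor <;> linarith
    · exact hB t
  have hG : ∀ A, MemLp (fun y => g S y * ∏ j, h A j (y j)) 2 (volume.restrict (unitCube d)) :=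
    fun A => (hg2 S).of_le_mul (c := ∏ _j : Fin d, B)
      ((hg2 S).1.mul (measurable_prod_comp (hmeas A)).aestronglyMeasurable)
      (.of_forall fun y => by
        rw [norm_mul, mul_comm]
        exact mul_le_mul_of_nonneg_right (abs_prod_comp_le (hbd A) y) (norm_nonneg _))
  refine KernelBounded.congr (KernelBounded.sum (s := Finset.univ)
    (e := fun (A : Finset (Fin d)) x => ∫ y in unitCube d, (g S y * ∏ j, h A j (y j)) *
      ∏ j ∈ A, stepFn (x j) (y j)) fun A _ => kernelBounded_integral hθ hγ A (hG A)) fun x _ => ?_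
  rw [← integral_finsetSum]
  · refine integral_congr_ae (.of_forall fun y => ?_)
    simp only [mul_assoc]
    rw [← Finset.mul_sum]
    congr 1
    have h1 : ∀ j, (if j ∈ S then 1 - stepFn (x j) (y j) - primitive w (y j) else w (y j)) =
        (if j ∈ S then -1 else 0) * stepFn (x j) (y j) +
          (if j ∈ S then 1 - primitive w (y j) else w (y j)) := fun j => by
      split_ifs <;> ring
    rw [Finset.prod_congr rfl fun j _ => h1 j, Fintype.prod_add]
    refine Finset.sum_congr rfl fun A _ => ?_
    rw [Finset.prod_mul_distrib, ← Finset.prod_mul_prod_compl A (fun j => h A j (y j)),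
      Finset.prod_congr rfl (s₁ := A) (f := fun j => h A j (y j))
        (g := fun j => if j ∈ S then -1 else 0) (fun j hj => if_pos hj),
      Finset.prod_congr rfl (s₁ := Aᶜ) (f := fun j => h A j (y j))
        (g := fun j => if j ∈ S then 1 - primitive w (y j) else w (y j))
        (fun j hj => if_neg (Finset.mem_compl.1 hj))]
    ring
  · intro A _
    exact ((hG A).integrable (by norm_num)).mul_bdd (measurable_prod_stepFn A x).aestronglyMeasurable
      (.of_forall (abs_prod_stepFn_le A x))

lemma bfKernel_comm {d : ℕ} (θ γ x x' : Fin d → ℝ) : bfKernel θ γ x x' = bfKernel θ γ x' x := by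
  simp only [bfKernel, min_comm]

/-! ### Kernel interpolation -/

section interpolation

variable {d : ℕ} {θ γ : Fin d → ℝ} {x : ℕ → Fin d → ℝ} {n : ℕ}

/-- The kernel interpolant of the first `n` observations. -/
noncomputable def interpolant {d : ℕ} (θ γ : Fin d → ℝ) (x : ℕ → Fin d → ℝ) (n : ℕ) (y : Fin n → ℝ)
    (z : Fin d → ℝ) : ℝ :=
  kernelVec θ γ x n z ⬝ᵥ ((kernelMatrix θ γ x n)⁻¹ *ᵥ y)

/-- The weights with which the observations enter the kernel interpolant at `z`. -/
noncomputable def interpWeights {d : ℕ} (θ γ : Fin d → ℝ) (x : ℕ → Fin d → ℝ) (n : ℕ)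
    (z : Fin d → ℝ) : Fin n → ℝ :=
  (kernelMatrix θ γ x n)⁻¹ *ᵥ kernelVec θ γ x n z

lemma kernelMatrix_transpose (θ γ : Fin d → ℝ) (x : ℕ → Fin d → ℝ) (n : ℕ) :
    (kernelMatrix θ γ x n)ᵀ = kernelMatrix θ γ x n := by
  ext i l; exact bfKernel_comm _ _ _ _

lemma dotProduct_kernelMatrix_mulVec (a b : Fin n → ℝ) :
    a ⬝ᵥ (kernelMatrix θ γ x n *ᵥ b) = (kernelMatrix θ γ x n *ᵥ a) ⬝ᵥ b := by
  rw [Matrix.dotProduct_mulVec, ← Matrix.mulVec_transpose, kernelMatrix_transpose]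

lemma interpolant_eq (y : Fin n → ℝ) (z : Fin d → ℝ) :
    interpolant θ γ x n y z = ∑ i, interpWeights θ γ x n z i * y i := by
  rw [interpolant, Matrix.dotProduct_mulVec, ← Matrix.mulVec_transpose,
    Matrix.transpose_nonsing_inv, kernelMatrix_transpose]
  rfl

lemma dotProduct_mulVec_eq_kernelForm (a : Fin n → ℝ) :
    a ⬝ᵥ (kernelMatrix θ γ x n *ᵥ a) = kernelForm θ γ (fun i : Fin n => x i) a := by
  simp only [dotProduct, Matrix.mulVec, kernelForm, kernelMatrix, Matrix.of_apply, Finset.mul_sum]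
  exact Finset.sum_congr rfl fun i _ => Finset.sum_congr rfl fun l _ => by ring

lemma isUnit_det_kernelMatrix (hθ : ∀ j, 0 < θ j) (hγ : ∀ j, 0 < γ j)
    (hx : ∀ i : Fin n, x i ∈ unitCube d) (hinj : Function.Injective fun i : Fin n => x i) :
    IsUnit (kernelMatrix θ γ x n).det := by
  rw [isUnit_iff_ne_zero]
  intro h
  obtain ⟨a, ha, h0⟩ := Matrix.exists_mulVec_eq_zero_iff.2 h
  have := kernelForm_pos hθ hγ hx hinj ha
  rw [← dotProduct_mulVec_eq_kernelForm, h0, dotProduct_zero] at this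
  exact this.false

lemma kernelMatrix_mulVec_interpWeights (hu : IsUnit (kernelMatrix θ γ x n).det)
    (z : Fin d → ℝ) :
    kernelMatrix θ γ x n *ᵥ interpWeights θ γ x n z = kernelVec θ γ x n z := by
  rw [interpWeights, Matrix.mulVec_mulVec, Matrix.mul_nonsing_inv _ hu, Matrix.one_mulVec]

lemma kernelForm_cons {p : Fin n → Fin d → ℝ} (z : Fin d → ℝ) (c : Fin n → ℝ) :
    kernelForm θ γ (Fin.cons z p : Fin (n + 1) → Fin d → ℝ) (Fin.cons 1 (-c) : Fin (n + 1) → ℝ) =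
      bfKernel θ γ z z - 2 * ∑ i, c i * bfKernel θ γ (p i) z + kernelForm θ γ p c := by
  simp only [kernelForm, Fin.sum_univ_succ, Fin.cons_zero, Fin.cons_succ, Pi.neg_apply,
    Finset.sum_add_distrib, bfKernel_comm θ γ z]
  simp only [one_mul, mul_one, neg_mul, mul_neg, neg_neg, Finset.sum_neg_distrib]
  ring

lemma kernelForm_cons_interpWeights (hu : IsUnit (kernelMatrix θ γ x n).det) (z : Fin d → ℝ) :
    kernelForm θ γ (Fin.cons z fun i : Fin n => x i : Fin (n + 1) → Fin d → ℝ)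
        (Fin.cons 1 (-interpWeights θ γ x n z) : Fin (n + 1) → ℝ) =
      bfKernel θ γ z z - interpWeights θ γ x n z ⬝ᵥ kernelVec θ γ x n z := by
  rw [kernelForm_cons, ← dotProduct_mulVec_eq_kernelForm, kernelMatrix_mulVec_interpWeights hu]
  simp only [dotProduct, kernelVec]
  ring

/-- The weights solve the normal equations of projecting the feature of `z` onto the span, so the
two sides differ by the form of `c` minus the weights, which is nonnegative. -/
lemma kernelForm_cons_interpWeights_le (hθ : ∀ j, 0 < θ j) (hγ : ∀ j, 0 < γ j)
    (hx : ∀ i : Fin n, x i ∈ unitCube d) (hu : IsUnit (kernelMatrix θ γ x n).det)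
    (z : Fin d → ℝ) (c : Fin n → ℝ) :
    kernelForm θ γ (Fin.cons z fun i : Fin n => x i : Fin (n + 1) → Fin d → ℝ)
        (Fin.cons 1 (-interpWeights θ γ x n z) : Fin (n + 1) → ℝ) ≤
      kernelForm θ γ (Fin.cons z fun i : Fin n => x i : Fin (n + 1) → Fin d → ℝ)
        (Fin.cons 1 (-c) : Fin (n + 1) → ℝ) := by
  have h := kernelForm_nonneg hθ hγ hx (c - interpWeights θ γ x n z)
  rw [kernelForm_cons_interpWeights hu, kernelForm_cons, ← dotProduct_mulVec_eq_kernelForm]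
  rw [← dotProduct_mulVec_eq_kernelForm, Matrix.mulVec_sub, sub_dotProduct, dotProduct_sub,
    dotProduct_sub, dotProduct_kernelMatrix_mulVec (interpWeights θ γ x n z) c,
    kernelMatrix_mulVec_interpWeights hu] at h
  have h1 : ∑ i, c i * bfKernel θ γ (x i) z = c ⬝ᵥ kernelVec θ γ x n z := rfl
  rw [h1]
  rw [dotProduct_comm (kernelVec θ γ x n z) c] at h
  linarith

lemma krr_zero_eq (y : ℕ → ℝ) (z : Fin d → ℝ) :
    krr θ γ 0 x y n z = interpolant θ γ x n (fun i => y i) z := by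
  simp [krr, interpolant]

/-- The Stage 1 estimate is a combination of kernel sections at the first `n` points, hence is its
own interpolant there. Adding the interpolated residual therefore cancels it. -/
lemma surrogateMean_eq_interpolant (hu : IsUnit (kernelMatrix θ γ x n).det) {n₀ : ℕ} (hn : n₀ ≤ n)
    (y : ℕ → ℝ) (z : Fin d → ℝ) :
    surrogateMean θ γ 0 0 (fun _ => 1) n₀ x y n z = interpolant θ γ x n (fun i => y i) z := by
  -- The Stage 1 coefficients, padded by zeros.
  let b : ℕ → ℝ := fun i => if h : i < n₀ then
    ((kernelMatrix θ γ x n₀)⁻¹ *ᵥ fun i : Fin n₀ => y i) ⟨i, h⟩ else 0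
  have hb : ∀ z, krr θ γ 0 x y n₀ z = kernelVec θ γ x n z ⬝ᵥ fun i : Fin n => b i := fun z => by
    rw [krr_zero_eq, interpolant]
    simp only [dotProduct, kernelVec]
    rw [Fin.sum_univ_eq_sum_range (fun i => bfKernel θ γ (x i) z * b i) n,
      ← Finset.sum_subset (Finset.range_mono hn) fun i _ hi => by
        simp only [Finset.mem_range] at hi
        simp [b, hi],
      ← Fin.sum_univ_eq_sum_range (fun i => bfKernel θ γ (x i) z * b i) n₀]
    exact Finset.sum_congr rfl fun i _ => by simp [b]
  have hres : (fun i : Fin n => y i - krr θ γ 0 x y n₀ (x i)) =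
      (fun i : Fin n => y i) - kernelMatrix θ γ x n *ᵥ fun i : Fin n => b i := by
    ext i
    simp only [hb, Pi.sub_apply, Matrix.mulVec, sub_right_inj]
    exact congrArg (· ⬝ᵥ _) (funext fun l => bfKernel_comm _ _ _ _)
  rw [surrogateMean, hres, hb]
  simp only [one_pow, one_smul, ne_eq, OfNat.ofNat_ne_zero, not_false_eq_true, zero_pow, zero_smul,
    add_zero, one_mul]
  rw [Matrix.mulVec_sub, Matrix.mulVec_mulVec, Matrix.nonsing_inv_mul _ hu, Matrix.one_mulVec,
    dotProduct_sub, interpolant]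
  ring

lemma surrogateVar_eq (z : Fin d → ℝ) : surrogateVar θ γ 0 (fun _ => 1) x n z =
    bfKernel θ γ z z - interpWeights θ γ x n z ⬝ᵥ kernelVec θ γ x n z := by
  simp [surrogateVar, interpWeights, dotProduct_comm]

/-- The variance is the kernel form at the `n + 1` distinct points `z, x i`, with coefficient `1` at
`z`. -/
lemma surrogateVar_pos (hθ : ∀ j, 0 < θ j) (hγ : ∀ j, 0 < γ j)
    (hx : ∀ i : Fin n, x i ∈ unitCube d) (hinj : Function.Injective fun i : Fin n => x i)
    {z : Fin d → ℝ} (hz : z ∈ unitCube d) (hzx : ∀ i : Fin n, x i ≠ z) :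
    0 < surrogateVar θ γ 0 (fun _ => 1) x n z := by
  rw [surrogateVar_eq, ← kernelForm_cons_interpWeights (isUnit_det_kernelMatrix hθ hγ hx hinj)]
  refine kernelForm_pos hθ hγ (Fin.cases hz hx)
    (Fin.cons_injective_iff.2 ⟨fun ⟨i, hi⟩ => hzx i hi, hinj⟩) fun h => ?_
  simpa using congrFun h 0

lemma surrogateVar_self (hu : IsUnit (kernelMatrix θ γ x n).det) (i : Fin n) :
    surrogateVar θ γ 0 (fun _ => 1) x n (x i) = 0 := by
  have : kernelVec θ γ x n (x i) = kernelMatrix θ γ x n *ᵥ Pi.single i 1 := by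
    ext l; simp [kernelVec, kernelMatrix]
  rw [surrogateVar_eq, interpWeights, this, Matrix.mulVec_mulVec, Matrix.nonsing_inv_mul _ hu,
    Matrix.one_mulVec]
  simp [kernelMatrix]

/-- The error of kernel interpolation at `z` is bounded by the distance of the feature of `z` to
the span of the features of the design points. -/
lemma KernelBounded.exists_abs_sub_interpolant_le (hθ : ∀ j, 0 < θ j) (hγ : ∀ j, 0 < γ j)
    {f : (Fin d → ℝ) → ℝ} (hf : KernelBounded θ γ f) :
    ∃ M, 0 ≤ M ∧ ∀ (n : ℕ) (x : ℕ → Fin d → ℝ), (∀ i : Fin n, x i ∈ unitCube d) →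
      (Function.Injective fun i : Fin n => x i) → ∀ z ∈ unitCube d,
      ∀ F ∈ Submodule.span ℝ (Set.range fun i : Fin n => orthantFn (x i)),
      |f z - interpolant θ γ x n (fun i => f (x i)) z| ≤
        M * √(∫ t, (orthantFn z t - F t) ^ 2 ∂fieldMeasure θ γ) := by
  obtain ⟨M, hM, h⟩ := hf
  refine ⟨M, hM, fun n x hx hinj z hz F hF => ?_⟩
  obtain ⟨c, rfl⟩ := (Submodule.mem_span_range_iff_exists_fun ℝ).1 hF
  have hu := isUnit_det_kernelMatrix hθ hγ hx hinj
  have hcube : ∀ i, (Fin.cons z fun i : Fin n => x i : Fin (n + 1) → Fin d → ℝ) i ∈ unitCube d :=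
    Fin.cases hz hx
  -- The error functional is evaluation at `z` minus the weighted evaluations at the design points.
  have h1 := h (n + 1) (Fin.cons z fun i : Fin n => x i)
    (Fin.cons 1 (-interpWeights θ γ x n z)) hcube
  simp only [Fin.sum_univ_succ, Fin.cons_zero, Fin.cons_succ, one_mul, Pi.neg_apply, neg_mul,
    Finset.sum_neg_distrib, ← sub_eq_add_neg] at h1
  rw [interpolant_eq]
  refine h1.trans (mul_le_mul_of_nonneg_left (Real.sqrt_le_sqrt ?_) hM)
  refine (kernelForm_cons_interpWeights_le hθ hγ hx hu z c).trans_eq ?_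
  rw [kernelForm_eq_integral hθ hγ hcube]
  refine integral_congr_ae (.of_forall fun t => ?_)
  simp [Fin.sum_univ_succ, Finset.sum_apply, sub_eq_add_neg]

end interpolation

/-! ### The expected improvement -/

lemma hasDerivAt_gaussianPDFReal (s : ℝ) :
    HasDerivAt (gaussianPDFReal 0 1) (-s * gaussianPDFReal 0 1 s) s := by
  have h : HasDerivAt (fun s : ℝ => (√(2 * Real.pi))⁻¹ * Real.exp (-s ^ 2 / 2))
      ((√(2 * Real.pi))⁻¹ * (Real.exp (-s ^ 2 / 2) * (-(2 * s) / 2))) s := by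
    have := (((hasDerivAt_pow 2 s).neg.div_const 2).exp).const_mul (√(2 * Real.pi))⁻¹
    simpa using this
  have e : gaussianPDFReal 0 1 = fun s : ℝ => (√(2 * Real.pi))⁻¹ * Real.exp (-s ^ 2 / 2) := by
    ext s; simp [gaussianPDFReal]
  rw [e]
  convert h using 1
  ring

lemma integral_Iic_neg_mul_gaussianPDFReal (t : ℝ) :
    IntegrableOn (fun s => -s * gaussianPDFReal 0 1 s) (Set.Iic t) ∧
      ∫ s in Set.Iic t, -s * gaussianPDFReal 0 1 s = gaussianPDFReal 0 1 t := by
  have e : gaussianPDFReal 0 1 = fun s : ℝ => (√(2 * Real.pi))⁻¹ * Real.exp (-(1 / 2) * s ^ 2) := by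
    ext s; simp only [gaussianPDFReal, NNReal.coe_one, mul_one, sub_zero]; congr 2; ring
  have hi : Integrable fun s => -s * gaussianPDFReal 0 1 s := by
    have := (integrable_mul_exp_neg_mul_sq (b := 1 / 2) (by norm_num)).const_mul
      (-(√(2 * Real.pi))⁻¹)
    refine this.congr (.of_forall fun s => ?_)
    simp only [e]; ring
  have ht : Filter.Tendsto (gaussianPDFReal 0 1) Filter.atBot (nhds 0) := by
    have h1 : Filter.Tendsto (fun s : ℝ => s ^ 2) Filter.atBot Filter.atTop := by
      simpa only [sq, id] using Filter.tendsto_id.atBot_mul_atBot₀ Filter.tendsto_id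
    have h2 := (Real.tendsto_exp_atBot.comp
      (h1.const_mul_atTop_of_neg (show -(1 / 2 : ℝ) < 0 by norm_num))).const_mul (√(2 * Real.pi))⁻¹
    rw [mul_zero] at h2
    rw [e]; exact h2
  refine ⟨hi.integrableOn, ?_⟩
  rw [integral_Iic_of_hasDerivAt_of_tendsto
    (hasDerivAt_gaussianPDFReal t).continuousAt.continuousWithinAt
    (fun s _ => hasDerivAt_gaussianPDFReal s) hi.integrableOn ht, sub_zero]

lemma cdf_gaussianReal_eq (t : ℝ) :
    cdf (gaussianReal 0 1) t = ∫ s in Set.Iic t, gaussianPDFReal 0 1 s := by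
  rw [cdf_eq_real, measureReal_def, gaussianReal_apply_eq_integral _ one_ne_zero,
    ENNReal.toReal_ofReal (integral_nonneg fun s => gaussianPDFReal_nonneg _ _ _)]

/-- Because `-s φ(s)` is the derivative of `φ`, the value equals `∫ (t - s) φ(s)` over `s ≤ t`,
whose integrand is positive for `s < t`. -/
lemma infoValue_pos (t : ℝ) : 0 < infoValue t := by
  obtain ⟨h1, h2⟩ := integral_Iic_neg_mul_gaussianPDFReal t
  have h3 := (integrable_gaussianPDFReal 0 1).integrableOn (s := Set.Iic t)
  have h4 : infoValue t = ∫ s in Set.Iic t, (t - s) * gaussianPDFReal 0 1 s := by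
    rw [infoValue, cdf_gaussianReal_eq, ← h2, ← integral_const_mul, ← integral_add
      (h3.const_mul t) h1]
    exact integral_congr_ae (.of_forall fun s => by ring)
  have h5 : IntegrableOn (fun s => (t - s) * gaussianPDFReal 0 1 s) (Set.Iic t) := by
    refine ((h3.const_mul t).add h1).congr (.of_forall fun s => ?_)
    simp only [Pi.add_apply]; ring
  rw [h4, integral_pos_iff_support_of_nonneg_ae ?_ h5]
  · refine (show 0 < (volume.restrict (Set.Iic t)) (Set.Ioo (t - 1) t) from ?_).trans_le
      (measure_mono fun s hs => ?_)
    · rw [Measure.restrict_apply measurableSet_Ioo, Set.inter_eq_left.2 fun s hs => hs.2.le]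
      simp
    · exact mul_ne_zero (sub_pos.2 hs.2).ne' (gaussianPDFReal_pos _ _ _ one_ne_zero).ne'
  · refine (ae_restrict_iff' measurableSet_Iic).2 (.of_forall fun s hs => ?_)
    exact mul_nonneg (sub_nonneg.2 hs) (gaussianPDFReal_nonneg _ _ _)

/-! ### Design points of a run. -/

lemma IsKEIBSRun.mem_unitCube {d : ℕ} {θ γ : Fin d → ℝ} {σ lam : ℝ} {δ : ℕ → ℝ} {N τ : ℕ}
    {x : ℕ → Fin d → ℝ} {y : ℕ → ℝ} (h : IsKEIBSRun θ γ σ lam δ N τ x y) {i : ℕ} (hi : i < N) :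
    x i ∈ unitCube d := by
  by_cases hc : i < (sparseGrid d τ).card
  · exact sparseGrid_subset (h.stage_one ▸ Finset.mem_image_of_mem x (Finset.mem_range.2 hc))
  · exact sparseGrid_subset (h.stage_two i (not_lt.1 hc) hi).1

/-- With noise-free samples the algorithm never samples a point twice. -/
lemma IsKEIBSRun.injective {d : ℕ} {θ γ : Fin d → ℝ} (hθ : ∀ j, 0 < θ j) (hγ : ∀ j, 0 < γ j)
    {N τ : ℕ} {x : ℕ → Fin d → ℝ} {y : ℕ → ℝ}
    (h : IsKEIBSRun θ γ 0 0 (fun _ => 1) N τ x y) {n : ℕ} (hn : (sparseGrid d τ).card ≤ n)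
    (hnN : n ≤ N) : Function.Injective fun i : Fin n => x i := by
  induction n, hn using Nat.le_induction with
  | base =>
    have : Set.InjOn x (Finset.range (sparseGrid d τ).card) := by
      rw [← Finset.card_image_iff, h.stage_one, Finset.card_range]
    intro i l hil
    exact Fin.ext (this (by simp) (by simp) hil)
  | succ n hn ih =>
    specialize ih (by omega)
    have hx : ∀ i : Fin n, x i ∈ unitCube d := fun i => h.mem_unitCube (by omega)
    have hu := isUnit_det_kernelMatrix hθ hγ hx ih
    obtain ⟨-, hmax⟩ := h.stage_two n hn (by omega)
    -- The candidate grid has more than `N` points, so it is never exhausted.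
    obtain ⟨z, hz, hzx⟩ : ∃ z ∈ sparseGrid d (τ + 1), z ∉ (Finset.range n).image x := by
      by_contra! hsub
      have h1 := Finset.card_le_card (show sparseGrid d (τ + 1) ⊆ _ from hsub)
      have h2 := Finset.card_image_le (s := Finset.range n) (f := x)
      have h3 := h.lt_card
      rw [Finset.card_range] at h2
      omega
    have hpos : 0 < expectedImprovement θ γ 0 0 (fun _ => 1) (sparseGrid d τ).card x y n z :=
      mul_pos (Real.sqrt_pos.2 (surrogateVar_pos hθ hγ hx ih (sparseGrid_subset hz) fun i hi =>
        hzx (Finset.mem_image.2 ⟨i, Finset.mem_range.2 i.2, hi⟩))) (infoValue_pos _)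
    have hnew : ∀ i : Fin n, x i ≠ x n := fun i hi => by
      have : expectedImprovement θ γ 0 0 (fun _ => 1) (sparseGrid d τ).card x y n (x n) = 0 := by
        -- The prefactor `√0` kills the product, whatever the division by zero inside `infoValue`
        -- returns.
        rw [← hi, expectedImprovement, surrogateVar_self hu]; simp
      have h1 := hmax hz
      simp only [Set.mem_ofPred_eq, this] at h1
      exact absurd hpos h1.not_gt
    intro i l hil
    rcases Nat.lt_succ_iff_lt_or_eq.1 i.2 with hi | hi <;>
      rcases Nat.lt_succ_iff_lt_or_eq.1 l.2 with hl | hl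
    · exact Fin.ext (Fin.mk.inj (@ih ⟨i, hi⟩ ⟨l, hl⟩ hil))
    · exact absurd (by simpa [hl] using hil) (hnew ⟨i, hi⟩)
    · exact absurd (by simpa [hi] using hil.symm) (hnew ⟨l, hl⟩)
    · exact Fin.ext (hi.trans hl.symm)

/-! ### From the level to the budget: the convergence rate. -/

lemma level_add_two_le {e N τ : ℕ} (hN : 2 ≤ N) (hτ : 1 ≤ τ)
    (h : (sparseGrid (e + 1) τ).card ≤ N) : (τ + 2 : ℝ) ≤ 4 / Real.log 2 * Real.log N := by
  have hlog2 : 0 < Real.log 2 := Real.log_pos (by norm_num)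
  have hN' : (2 : ℝ) ≤ N := by exact_mod_cast hN
  have h1 : 2 ^ τ ≤ N + 1 := by have := le_card_sparseGrid e hτ; omega
  -- This gives `τ log 2 ≤ 2 log N`; the remaining `2 log 2` is also at most `2 log N`, whence the
  -- constant `4`.
  have h2 : (2 : ℝ) ^ τ ≤ N ^ 2 := by
    have : (2 : ℝ) ^ τ ≤ N + 1 := by exact_mod_cast h1
    nlinarith
  have h3 := Real.log_le_log (by positivity) h2
  have h4 := Real.log_le_log (by norm_num) hN'
  rw [Real.log_pow, Real.log_pow] at h3
  rw [div_mul_eq_mul_div, le_div_iff₀ hlog2]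
  push_cast at h3
  linarith

lemma sqrt_half_pow_mul_sqrt_le {e N τ : ℕ} (h : N < (sparseGrid (e + 1) (τ + 1)).card) :
    √(1 / 2) ^ τ * √N ≤ √((τ + 2 : ℝ) ^ e * 2 ^ (e + 2)) := by
  have h1 := card_sparseGrid_le e (τ + 1)
  have h2 : (N : ℝ) ≤ (sparseGrid (e + 1) (τ + 1)).card := by exact_mod_cast h.le
  have h3 : √(1 / 2) ^ τ = √((1 / 2) ^ τ) := by
    rw [eq_comm, Real.sqrt_eq_iff_eq_sq (by positivity) (by positivity), ← pow_mul, mul_comm,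
      pow_mul, Real.sq_sqrt (by norm_num)]
  rw [h3, ← Real.sqrt_mul (by positivity)]
  refine Real.sqrt_le_sqrt ?_
  have h4 : (N : ℝ) ≤ (τ + 2 : ℝ) ^ e * 2 ^ (e + 2) * 2 ^ τ := by
    refine (h2.trans h1).trans_eq ?_
    push_cast
    ring
  calc (1 / 2 : ℝ) ^ τ * N ≤ (1 / 2) ^ τ * ((τ + 2 : ℝ) ^ e * 2 ^ (e + 2) * 2 ^ τ) :=
        mul_le_mul_of_nonneg_left h4 (by positivity)
    _ = _ := by rw [one_div, inv_pow]; field_simp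

lemma pow_mul_sqrt_pow {L : ℝ} (hL : 0 < L) (e : ℕ) :
    L ^ e * √(L ^ e) = L ^ (3 * (e : ℝ) / 2) := by
  rw [Real.sqrt_eq_rpow, ← Real.rpow_natCast, ← Real.rpow_mul hL.le, ← Real.rpow_add hL]
  congr 1; ring

/-- The uniform error bound for the final surrogate. -/
lemma exists_abs_sub_surrogateMean_le {e : ℕ} {θ γ : Fin (e + 1) → ℝ} (hθ : ∀ j, 0 < θ j)
    (hγ : ∀ j, 0 < γ j) {f : (Fin (e + 1) → ℝ) → ℝ} (hf : KernelBounded θ γ f) :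
    ∃ C : ℝ, ∀ N : ℕ, 2 ≤ N → ∀ (τ : ℕ) (x : ℕ → Fin (e + 1) → ℝ),
      IsKEIBSRun θ γ 0 0 (fun _ => 1) N τ x (fun i => f (x i)) → ∀ z ∈ unitCube (e + 1),
        |f z - surrogateMean θ γ 0 0 (fun _ => 1) (sparseGrid (e + 1) τ).card x
          (fun i => f (x i)) N z| ≤
          C * ((N : ℝ) ^ (-(1 / 2) : ℝ) * Real.log N ^ (3 * (e : ℝ) / 2)) := by
  obtain ⟨M, hM, hbound⟩ := hf.exists_abs_sub_interpolant_le hθ hγ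
  set r : ℝ := √(1 / 2) with hr
  have hr0 : 0 < r := Real.sqrt_pos.2 (by norm_num)
  have hr1 : r < 1 := by
    have : r ^ 2 = 1 / 2 := Real.sq_sqrt (by norm_num)
    nlinarith
  set K : ℝ := ∏ j, (θ j + 2 * γ j) with hK
  set A : ℝ := 4 / Real.log 2 with hA
  have hA0 : 0 < A := div_pos (by norm_num) (Real.log_pos (by norm_num))
  refine ⟨M * √K / (1 - r) * (A ^ e * √(A ^ e * 2 ^ (e + 2))), fun N hN τ x hrun z hz => ?_⟩
  have hN0 : (0 : ℝ) < N := by exact_mod_cast (by omega : 0 < N)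
  have hL : 0 < Real.log N := Real.log_pos (by exact_mod_cast (by omega : 1 < N))
  have hinj := hrun.injective hθ hγ hrun.card_le le_rfl
  have hcube : ∀ i : Fin N, x i ∈ unitCube (e + 1) := fun i => hrun.mem_unitCube i.2
  rw [surrogateMean_eq_interpolant (isUnit_det_kernelMatrix hθ hγ hcube hinj) hrun.card_le]
  obtain ⟨F, hF, hFle⟩ := exists_mem_span_integral_sq_le hrun.one_le_level hθ hγ hz
  -- Stage 2 points only enlarge the span that Stage 1 already provides.
  have hspan : F ∈ Submodule.span ℝ (Set.range fun i : Fin N => orthantFn (x i)) := by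
    refine Submodule.span_mono ?_ hF
    rintro _ ⟨p, hp, rfl⟩
    rw [Finset.mem_coe, ← hrun.stage_one] at hp
    obtain ⟨i, hi, rfl⟩ := Finset.mem_image.1 hp
    exact ⟨⟨i, (Finset.mem_range.1 hi).trans_le hrun.card_le⟩, rfl⟩
  have hlevel := level_add_two_le hN hrun.one_le_level hrun.card_le
  rw [← hA] at hlevel
  set L := Real.log N
  have hpow : (τ + 1 : ℝ) ^ e ≤ (A * L) ^ e := pow_le_pow_left₀ (by positivity) (by linarith) e
  have hsqrt : r ^ τ ≤ √((A * L) ^ e * 2 ^ (e + 2)) * (√N)⁻¹ := by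
    rw [← div_eq_mul_inv, le_div_iff₀ (Real.sqrt_pos.2 hN0)]
    refine (sqrt_half_pow_mul_sqrt_le hrun.lt_card).trans (Real.sqrt_le_sqrt ?_)
    exact mul_le_mul_of_nonneg_right (pow_le_pow_left₀ (by positivity) hlevel e) (by positivity)
  have h1r : 0 < 1 - r := sub_pos.2 hr1
  calc |f z - interpolant θ γ x N (fun i => f (x i)) z|
      ≤ M * √(∫ t, (orthantFn z t - F t) ^ 2 ∂fieldMeasure θ γ) := hbound N x hcube hinj z hz F hspan
    _ ≤ M * √(K * ((τ + 1 : ℝ) ^ e * (r ^ τ / (1 - r))) ^ 2) := by gcongr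
    _ = M * √K / (1 - r) * ((τ + 1 : ℝ) ^ e * r ^ τ) := by
        rw [Real.sqrt_mul' _ (sq_nonneg _), Real.sqrt_sq (by positivity)]
        field_simp
    _ ≤ M * √K / (1 - r) * ((A * L) ^ e * (√((A * L) ^ e * 2 ^ (e + 2)) * (√N)⁻¹)) := by gcongr
    _ = _ := by
        rw [mul_pow, mul_right_comm (A ^ e) (L ^ e) (2 ^ (e + 2)),
          Real.sqrt_mul' _ (by positivity : 0 ≤ L ^ e), ← pow_mul_sqrt_pow hL, Real.rpow_neg hN0.le, ← Real.sqrt_eq_rpow]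
        ring

theorem mainTheorem1 {d : ℕ} (hd : 1 ≤ d)
    (θ γ : Fin d → ℝ) (hθ : ∀ j, 0 < θ j) (hγ : ∀ j, 0 < γ j)
    (f : (Fin d → ℝ) → ℝ) (hf : MemHMixOne f) (hcont : ContinuousOn f (unitCube d))
    (xstar : Fin d → ℝ) (hxstar : xstar ∈ unitCube d) (hmax : IsMaxOn f (unitCube d) xstar) :
    ∃ C : ℝ, ∀ N : ℕ, 2 ≤ N → ∀ (τ : ℕ) (x : ℕ → Fin d → ℝ),
      IsKEIBSRun θ γ 0 0 (fun _ => 1) N τ x (fun i => f (x i)) →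
      ∀ ε : ℝ, 0 ≤ ε → ∀ xhat ∈ unitCube d,
        (∀ z ∈ unitCube d,
          surrogateMean θ γ 0 0 (fun _ => 1) (sparseGrid d τ).card x (fun i => f (x i)) N z ≤
            surrogateMean θ γ 0 0 (fun _ => 1) (sparseGrid d τ).card x (fun i => f (x i)) N xhat
              + ε) →
        f xstar - f xhat ≤
          C * ((N : ℝ) ^ (-(1 / 2) : ℝ) * Real.log N ^ (3 * ((d : ℝ) - 1) / 2)) + ε := by
  obtain ⟨e, rfl⟩ : ∃ e, d = e + 1 := ⟨d - 1, by omega⟩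
  obtain ⟨C, hC⟩ := exists_abs_sub_surrogateMean_le hθ hγ (hf.kernelBounded hθ hγ hcont)
  -- The uniform error is paid at `xstar` and again at `xhat`.
  refine ⟨2 * C, fun N hN τ x hrun ε _ xhat hxhat hopt => ?_⟩
  have h1 := (abs_le.1 (hC N hN τ x hrun xstar hxstar)).2
  have h2 := (abs_le.1 (hC N hN τ x hrun xhat hxhat)).1
  have h3 := hopt xstar hxstar
  have he : 3 * (((e + 1 : ℕ) : ℝ) - 1) / 2 = 3 * (e : ℝ) / 2 := by push_cast; ring
  rw [he]
  linarith
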